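/- All symmetric monoidal categories (SMCs) and symmetric monoidal functors are strict. A dagger-SMC is an SMC with an identity-on-objects, involutive, contravariant symmetric monoidal functor $\dagger$; an isometry is a morphism $f$ with $f^\dagger\circ f=1$. An SMC is compact closed (CC) if every object $A$ has a dual $A^*$ with morphisms $A\otimes A^*\to I$ and $I\to A^*\otimes A$ satisfying the snake equations; a dagger-SMC is dagger compact ($\dagger$-CC) if moreover these can be chosen so that the dagger of $A\otimes A^*\to I$ is $I\to A^*\otimes A$ followed by the symmetry. Let $\mathbf{FHilb}$ be the category with objects $\mathbb C^n$ ($n\in\mathbb N$) and morphisms the linear maps, with the usual tensor product ($\mathbb C^m\otimes\mathbb C^n=\mathbb C^{mn}$) and the adjoint as dagger, and let $\mathbf{Qubit}$ be its full subcategory on the objects $\mathbb C^{2^n}$, a $\dagger$-CC. Discard construction. For a dagger-SMC $\mathbf C$, let $\mathbf C_{iso}$ be the SMC with the objects of $\mathbf C$ and the isometries as morphisms. Let $\mathbf C_{iso}^{!}$ be the SMC obtained from $\mathbf C_{iso}$ by adjoining, for each object $A$, a morphism $!_A:A\to I$, subject to $!_I=1_I$ and $!_B\circ f=\,!_A$ for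 every $f:A\to B$ of $\mathbf C_{iso}^{!}$ (so that $I$ is terminal). Let $\mathbf C^{\mathrm{disc}}$ (also written C^⏚) be the pushout of $\mathbf C\leftarrow\mathbf C_{iso}\to\mathbf C_{iso}^{!}$: it has the objects of $\mathbf C$, and its morphisms are the formal composites and tensor products of morphisms of $\mathbf C$ and of $\mathbf C_{iso}^{!}$, modulo the SMC axioms, the equations of both categories and the identification of the two copies of each isometry. It comes with an identity-on-objects functor $\iota:\mathbf C\to\mathbf C^{\mathrm{disc}}$ and with discard maps $\mathrm{disc}_A:A\to I$, the images of the $!_A$. Environment structures. An environment structure for a $\dagger$-CC $\mathbf C$ consists of a CC $\overline{\mathbf C}$ with the same objects, an identity-on-objects symmetric monoidal functor $\iota:\mathbf C\to\overline{\mathbf C}$, and a morphism $\mathrm{disc}_A:A\to I$ of $\overline{\mathbf C}$ for each object $A$, such that: 1. $\mathrm{disc}_I=1_I$ and $\mathrm{disc}_A\otimes\mathrm{disc}_B=\mathrm{disc}_{A\otimes B}$ for all $A,B$; 2. for every $f:A\to B$ in $\overline{\mathbf C}$ there are an object $X$ and $f':A\to B\otimes X$ in $\mathbf C$ with $f=(1_B\otimes\mathrm{disc}_X)\circ\iota(f')$;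 3. for all $f:A\to B\otimes X$ and $g:A\to B\otimes Y$ in $\mathbf C$, $f\sim_{cp}g$ if and only if $(1_B\otimes\mathrm{disc}_X)\circ\iota(f)=(1_B\otimes\mathrm{disc}_Y)\circ\iota(g)$. Here $f\sim_{cp}g$ means that $$(1_B\otimes f^\dagger)\circ(1_B\otimes\sigma_{X,B})\circ(f\otimes 1_B)=(1_B\otimes g^\dagger)\circ(1_B\otimes\sigma_{Y,B})\circ(g\otimes 1_B)$$ as morphisms $A\otimes B\to B\otimes A$. Proposition. $\mathbf{Qubit}^{\mathrm{disc}}$, with its functor $\iota:\mathbf{Qubit}\to\mathbf{Qubit}^{\mathrm{disc}}$ and its discard maps $\mathrm{disc}_A$, is an environment structure for $\mathbf{Qubit}$. -/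

import Mathlib

open CategoryTheory MonoidalCategory
open scoped TensorProduct

universe w v u v₂ u₂

/-! ### Strict symmetric monoidal categories, daggers, compactness -/

/-- A monoidal category is strict: `(A ⊗ B) ⊗ D = A ⊗ (B ⊗ D)` and `I ⊗ A = A = A ⊗ I`, the
structural isomorphisms being identities. -/
class IsStrictMonoidal (C : Type u) [Category.{v} C] [MonoidalCategory C] : Prop where
  associator_eq (A B D : C) :
    ∃ h : (A ⊗ B) ⊗ D = A ⊗ (B ⊗ D), (α_ A B D).hom = eqToHom h
  leftUnitor_eq (A : C) : ∃ h : 𝟙_ C ⊗ A = A, (λ_ A).hom = eqToHom h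
  rightUnitor_eq (A : C) : ∃ h : A ⊗ 𝟙_ C = A, (ρ_ A).hom = eqToHom h

/-- A monoidal functor is strict: it preserves unit and tensor on the nose. -/
class IsStrictMonoidalFunctor {C : Type u} [Category.{v} C] [MonoidalCategory C]
    {D : Type u₂} [Category.{v₂} D] [MonoidalCategory D] (F : C ⥤ D) [F.Monoidal] : Prop where
  unit_eq : ∃ h : 𝟙_ D = F.obj (𝟙_ C), Functor.LaxMonoidal.ε F = eqToHom h
  tensor_eq (A B : C) :
    ∃ h : F.obj A ⊗ F.obj B = F.obj (A ⊗ B), Functor.LaxMonoidal.μ F A B = eqToHom h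

/-- A dagger symmetric monoidal category: an identity-on-objects, involutive, contravariant
symmetric monoidal functor `†`. -/
class DaggerSMC (C : Type u) [Category.{v} C] [MonoidalCategory C] [SymmetricCategory C] where
  /-- The dagger of a morphism. -/
  dagger : ∀ {A B : C}, (A ⟶ B) → (B ⟶ A)
  dagger_dagger : ∀ {A B : C} (f : A ⟶ B), dagger (dagger f) = f
  dagger_id : ∀ A : C, dagger (𝟙 A) = 𝟙 A
  dagger_comp : ∀ {A B D : C} (f : A ⟶ B) (g : B ⟶ D), dagger (f ≫ g) = dagger g ≫ dagger f
  dagger_tensor : ∀ {A B A' B' : C} (f : A ⟶ B) (g : A' ⟶ B'),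
    dagger (f ⊗ₘ g) = dagger f ⊗ₘ dagger g
  dagger_associator : ∀ A B D : C, dagger (α_ A B D).hom = (α_ A B D).inv
  dagger_leftUnitor : ∀ A : C, dagger (λ_ A).hom = (λ_ A).inv
  dagger_rightUnitor : ∀ A : C, dagger (ρ_ A).hom = (ρ_ A).inv
  dagger_braiding : ∀ A B : C, dagger (β_ A B).hom = (β_ B A).hom

open DaggerSMC (dagger)

/-- A symmetric monoidal category is compact closed: every object `A` has a dual `A'`, with
`I ⟶ A' ⊗ A` and `A ⊗ A' ⟶ I` satisfying the snake equations. -/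
class IsCompactClosed (C : Type u) [Category.{v} C] [MonoidalCategory C] [SymmetricCategory C] :
    Prop where
  exists_dual : ∀ A : C, ∃ A' : C, Nonempty (ExactPairing A' A)

/-- A dagger symmetric monoidal category is dagger compact: every object `A` has a dual `A'`,
and the dagger of `A ⊗ A' ⟶ I` is `I ⟶ A' ⊗ A` followed by the symmetry. -/
class IsDaggerCompact (C : Type u) [Category.{v} C] [MonoidalCategory C] [SymmetricCategory C]
    [DaggerSMC C] : Prop where
  exists_dual : ∀ A : C, ∃ A' : C, ∃ _ : ExactPairing A' A,
    dagger (ε_ A' A) = η_ A' A ≫ (β_ A' A).hom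

/-! ### Environment structures -/

section Environment

variable {C : Type u} [Category.{v} C] [MonoidalCategory C] [SymmetricCategory C]

/-- The diagram `(1_B ⊗ f†) ∘ (1_B ⊗ σ) ∘ (f ⊗ 1_B) : A ⊗ B ⟶ B ⊗ A` in which the auxiliary
output `X` of `f` is plugged into `f†`, the two `B`-wires being left open. -/
def cpDiagram [DaggerSMC C] {A B X : C} (f : A ⟶ B ⊗ X) : A ⊗ B ⟶ B ⊗ A :=
  (f ▷ B) ≫ (α_ B X B).hom ≫ (B ◁ (β_ X B).hom) ≫ (B ◁ dagger f)

/-- The relation `f ∼cp g`. -/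
def CPRel [DaggerSMC C] {A B X Y : C} (f : A ⟶ B ⊗ X) (g : A ⟶ B ⊗ Y) : Prop :=
  cpDiagram f = cpDiagram g

variable {D : Type u₂} [Category.{v₂} D] [MonoidalCategory D] [SymmetricCategory D]

/-- The morphism `(1_B ⊗ ⏚_X) ∘ ι f : A ⟶ B` obtained from `f : A ⟶ B ⊗ X` by
discarding `X`. -/
def discardOutput (F : C ⥤ D) [F.Monoidal] (disc : ∀ A : C, F.obj A ⟶ 𝟙_ D)
    {A B X : C} (f : A ⟶ B ⊗ X) : F.obj A ⟶ F.obj B :=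
  F.map f ≫ Functor.OplaxMonoidal.δ F B X ≫ (F.obj B ◁ disc X) ≫ (ρ_ (F.obj B)).hom

/-- `F : C ⥤ D` together with the discard maps `disc` is an environment structure for the strict
dagger compact category `C`. -/
structure IsEnvironmentStructure [IsStrictMonoidal C] [DaggerSMC C] [IsDaggerCompact C]
    (F : C ⥤ D) [F.Braided] (disc : ∀ A : C, F.obj A ⟶ 𝟙_ D) : Prop where
  /-- `D` is a strict symmetric monoidal category. -/
  strict : IsStrictMonoidal D
  /-- `D` is compact closed. -/
  compactClosed : IsCompactClosed D
  /-- `F` identifies the objects of `C` with those of `D`. -/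
  bijective_obj : Function.Bijective F.obj
  /-- `F` is a strict symmetric monoidal functor. -/
  strict_functor : IsStrictMonoidalFunctor F
  /-- `⏚_I = 1_I`. -/
  disc_unit : disc (𝟙_ C) = Functor.OplaxMonoidal.η F
  /-- `⏚_A ⊗ ⏚_B = ⏚_{A ⊗ B}`. -/
  disc_tensor : ∀ A B : C, disc (A ⊗ B) =
    Functor.OplaxMonoidal.δ F A B ≫ (disc A ⊗ₘ disc B) ≫ (λ_ (𝟙_ D)).hom
  /-- Every morphism has a purification. -/
  exists_purification : ∀ {A B : C} (f : F.obj A ⟶ F.obj B),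
    ∃ (X : C) (f' : A ⟶ B ⊗ X), f = discardOutput F disc f'
  /-- Two morphisms purify the same morphism exactly when they are related by `∼cp`. -/
  cp_iff : ∀ {A B X Y : C} (f : A ⟶ B ⊗ X) (g : A ⟶ B ⊗ Y),
    CPRel f g ↔ discardOutput F disc f = discardOutput F disc g

end Environment

/-! ### Adjoining morphisms to a symmetric monoidal category -/

section Adjoin

variable {C : Type u} [Category.{v} C] [MonoidalCategory C]

/-- Formal composites and tensor products of morphisms of `C` and of new generators `G`. -/
inductive FormalHom (G : C → C → Type w) : C → C → Type (max u v w)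
  | base {A B : C} (f : A ⟶ B) : FormalHom G A B
  | gen {A B : C} (g : G A B) : FormalHom G A B
  | comp {A B E : C} (s : FormalHom G A B) (t : FormalHom G B E) : FormalHom G A E
  | tensor {A B A' B' : C} (s : FormalHom G A B) (t : FormalHom G A' B') : FormalHom G (A ⊗ A') (B ⊗ B')

/-- The least congruence on formal morphisms that contains the equations of `C`, the axioms of
symmetric monoidal categories (the structural morphisms being those of `C`), and the given
relations `R`. -/
inductive FormalRel [SymmetricCategory C] (G : C → C → Type w)
    (R : ∀ ⦃A B : C⦄, FormalHom G A B → FormalHom G A B → Prop) :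
    ∀ {A B : C}, FormalHom G A B → FormalHom G A B → Prop
  | of {A B : C} {s t : FormalHom G A B} : R s t → FormalRel G R s t
  | refl {A B : C} (s : FormalHom G A B) : FormalRel G R s s
  | symm {A B : C} {s t : FormalHom G A B} : FormalRel G R s t → FormalRel G R t s
  | trans {A B : C} {s t r : FormalHom G A B} :
      FormalRel G R s t → FormalRel G R t r → FormalRel G R s r
  | comp_congr {A B E : C} {s s' : FormalHom G A B} {t t' : FormalHom G B E} :
      FormalRel G R s s' → FormalRel G R t t' → FormalRel G R (s.comp t) (s'.comp t')
  | tensor_congr {A B A' B' : C} {s s' : FormalHom G A B} {t t' : FormalHom G A' B'} :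
      FormalRel G R s s' → FormalRel G R t t' → FormalRel G R (s.tensor t) (s'.tensor t')
  | base_comp {A B E : C} (f : A ⟶ B) (g : B ⟶ E) :
      FormalRel G R ((FormalHom.base f).comp (.base g)) (.base (f ≫ g))
  | base_tensor {A B A' B' : C} (f : A ⟶ B) (g : A' ⟶ B') :
      FormalRel G R ((FormalHom.base f).tensor (.base g)) (.base (f ⊗ₘ g))
  | id_comp {A B : C} (s : FormalHom G A B) : FormalRel G R ((FormalHom.base (𝟙 A)).comp s) s
  | comp_id {A B : C} (s : FormalHom G A B) : FormalRel G R (s.comp (.base (𝟙 B))) s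
  | assoc {A B E H : C} (s : FormalHom G A B) (t : FormalHom G B E) (r : FormalHom G E H) :
      FormalRel G R ((s.comp t).comp r) (s.comp (t.comp r))
  | tensor_comp {A B E A' B' E' : C} (s : FormalHom G A B) (s' : FormalHom G A' B')
      (t : FormalHom G B E) (t' : FormalHom G B' E') :
      FormalRel G R ((s.tensor s').comp (t.tensor t')) ((s.comp t).tensor (s'.comp t'))
  | associator_naturality {A B A' B' A'' B'' : C} (s : FormalHom G A B) (s' : FormalHom G A' B')
      (s'' : FormalHom G A'' B'') :
      FormalRel G R (((s.tensor s').tensor s'').comp (.base (α_ B B' B'').hom))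
        ((FormalHom.base (α_ A A' A'').hom).comp (s.tensor (s'.tensor s'')))
  | leftUnitor_naturality {A B : C} (s : FormalHom G A B) :
      FormalRel G R (((FormalHom.base (𝟙 (𝟙_ C))).tensor s).comp (.base (λ_ B).hom))
        ((FormalHom.base (λ_ A).hom).comp s)
  | rightUnitor_naturality {A B : C} (s : FormalHom G A B) :
      FormalRel G R ((s.tensor (.base (𝟙 (𝟙_ C)))).comp (.base (ρ_ B).hom))
        ((FormalHom.base (ρ_ A).hom).comp s)
  | braiding_naturality {A B A' B' : C} (s : FormalHom G A B) (s' : FormalHom G A' B') :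
      FormalRel G R ((s.tensor s').comp (.base (β_ B B').hom))
        ((FormalHom.base (β_ A A').hom).comp (s'.tensor s))

variable [SymmetricCategory C]

/-- The setoid of formal morphisms modulo `FormalRel`. -/
def formalSetoid (G : C → C → Type w) (R : ∀ ⦃A B : C⦄, FormalHom G A B → FormalHom G A B → Prop)
    (A B : C) : Setoid (FormalHom G A B) :=
  ⟨FormalRel G R, .refl, .symm, .trans⟩

/-- The symmetric monoidal category obtained from `C` by adjoining the morphisms `G` subject to
the relations `R`. It has the objects of `C`. -/
structure Adjoin (G : C → C → Type w)
    (_R : ∀ ⦃A B : C⦄, FormalHom G A B → FormalHom G A B → Prop) where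
  /-- The underlying object of `C`. -/
  of : C

namespace Adjoin

variable (G : C → C → Type w) (R : ∀ ⦃A B : C⦄, FormalHom G A B → FormalHom G A B → Prop)

instance : CategoryStruct (Adjoin G R) where
  Hom A B := Quotient (formalSetoid G R A.of B.of)
  id A := Quotient.mk _ (.base (𝟙 A.of))
  comp := Quotient.map₂ FormalHom.comp fun _ _ h _ _ h' => .comp_congr h h'

variable {G R} in
/-- The morphism represented by a formal morphism. -/
def homMk {A B : C} (s : FormalHom G A B) : (⟨A⟩ : Adjoin G R) ⟶ ⟨B⟩ :=
  Quotient.mk (formalSetoid G R A B) s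

variable {G R} in
theorem homMk_eq {A B : C} {s t : FormalHom G A B} (h : FormalRel G R s t) :
    (homMk s : (⟨A⟩ : Adjoin G R) ⟶ ⟨B⟩) = homMk t :=
  Quotient.sound (s := formalSetoid G R A B) h

instance : Category (Adjoin G R) where
  id_comp := by rintro A B ⟨s⟩; exact homMk_eq (.id_comp s)
  comp_id := by rintro A B ⟨s⟩; exact homMk_eq (.comp_id s)
  assoc := by rintro A B E H ⟨s⟩ ⟨t⟩ ⟨r⟩; exact homMk_eq (.assoc s t r)

variable {G R} in
theorem base_comp {A B E : C} (f : A ⟶ B) (g : B ⟶ E) :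
    (homMk (.base f) : (⟨A⟩ : Adjoin G R) ⟶ ⟨B⟩) ≫ (homMk (.base g) : _ ⟶ ⟨E⟩) =
      homMk (.base (f ≫ g)) :=
  homMk_eq (.base_comp f g)

variable {G R} in
/-- An isomorphism of `C`, as an isomorphism of the extended category. -/
def isoMk {A B : C} (e : A ≅ B) : (⟨A⟩ : Adjoin G R) ≅ ⟨B⟩ where
  hom := homMk (.base e.hom)
  inv := homMk (.base e.inv)
  hom_inv_id := by rw [base_comp, e.hom_inv_id]; rfl
  inv_hom_id := by rw [base_comp, e.inv_hom_id]; rfl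

instance : MonoidalCategoryStruct (Adjoin G R) where
  tensorObj A B := ⟨A.of ⊗ B.of⟩
  tensorUnit := ⟨𝟙_ C⟩
  tensorHom := Quotient.map₂ FormalHom.tensor fun _ _ h _ _ h' => .tensor_congr h h'
  whiskerLeft A _ _ := Quotient.map (fun t => FormalHom.tensor (.base (𝟙 A.of)) t)
    fun _ _ h => .tensor_congr (.refl _) h
  whiskerRight f B := Quotient.map (fun t => FormalHom.tensor t (.base (𝟙 B.of)))
    (fun _ _ h => .tensor_congr h (.refl _)) f
  associator A B E := isoMk (α_ A.of B.of E.of)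
  leftUnitor A := isoMk (λ_ A.of)
  rightUnitor A := isoMk (ρ_ A.of)

variable {G R} in
theorem base_tensor {A B A' B' : C} (f : A ⟶ B) (g : A' ⟶ B') :
    (homMk (.base f) : (⟨A⟩ : Adjoin G R) ⟶ ⟨B⟩) ⊗ₘ (homMk (.base g) : ⟨A'⟩ ⟶ ⟨B'⟩) =
      homMk (.base (f ⊗ₘ g)) :=
  homMk_eq (.base_tensor f g)

instance : MonoidalCategory (Adjoin G R) :=
  MonoidalCategory.ofTensorHom
    (id_tensorHom_id := fun A B =>
      (base_tensor (𝟙 A.of) (𝟙 B.of)).trans (by rw [id_tensorHom_id]; rfl))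
    (id_tensorHom := by rintro A B B' ⟨s⟩; rfl)
    (tensorHom_id := by rintro B B' ⟨s⟩ A; rfl)
    (tensorHom_comp_tensorHom := by
      rintro A B E A' B' E' ⟨s⟩ ⟨s'⟩ ⟨t⟩ ⟨t'⟩; exact homMk_eq (.tensor_comp s s' t t'))
    (associator_naturality := by
      rintro _ _ _ _ _ _ ⟨s⟩ ⟨s'⟩ ⟨s''⟩; exact homMk_eq (.associator_naturality s s' s''))
    (leftUnitor_naturality := by rintro _ _ ⟨s⟩; exact homMk_eq (.leftUnitor_naturality s))
    (rightUnitor_naturality := by rintro _ _ ⟨s⟩; exact homMk_eq (.rightUnitor_naturality s))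
    (pentagon := fun W X Y Z => by
      have h := congrArg (fun f => (homMk (.base f) : (⟨_⟩ : Adjoin G R) ⟶ ⟨_⟩))
        (MonoidalCategory.pentagon W.of X.of Y.of Z.of)
      simp only [← base_comp, ← tensorHom_id, ← id_tensorHom, ← base_tensor] at h
      exact h)
    (triangle := fun X Y => by
      have h := congrArg (fun f => (homMk (.base f) : (⟨_⟩ : Adjoin G R) ⟶ ⟨_⟩))
        (MonoidalCategory.triangle X.of Y.of)
      simp only [← base_comp, ← tensorHom_id, ← id_tensorHom, ← base_tensor] at h
      exact h)

instance : SymmetricCategory (Adjoin G R) where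
  braiding A B := isoMk (β_ A.of B.of)
  braiding_naturality_right := by
    rintro A B B' ⟨s⟩; exact homMk_eq (.braiding_naturality (.base (𝟙 A.of)) s)
  braiding_naturality_left := by
    rintro B B' ⟨s⟩ A; exact homMk_eq (.braiding_naturality s (.base (𝟙 A.of)))
  hexagon_forward X Y Z := by
    have h := congrArg (fun f => (homMk (.base f) : (⟨_⟩ : Adjoin G R) ⟶ ⟨_⟩))
      (BraidedCategory.hexagon_forward X.of Y.of Z.of)
    simp only [← base_comp, ← tensorHom_id, ← id_tensorHom, ← base_tensor] at h
    exact h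
  hexagon_reverse X Y Z := by
    have h := congrArg (fun f => (homMk (.base f) : (⟨_⟩ : Adjoin G R) ⟶ ⟨_⟩))
      (BraidedCategory.hexagon_reverse X.of Y.of Z.of)
    simp only [← base_comp, ← tensorHom_id, ← id_tensorHom, ← base_tensor] at h
    exact h
  symmetry X Y := (base_comp _ _).trans (by rw [SymmetricCategory.symmetry]; rfl)

/-- The inclusion of `C`, which is the identity on objects. -/
def incl : C ⥤ Adjoin G R where
  obj A := ⟨A⟩
  map f := homMk (.base f)
  map_id _ := rfl
  map_comp f g := (base_comp f g).symm

theorem incl_tensor {A B A' B' : C} (f : A ⟶ B) (g : A' ⟶ B') :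
    ((incl G R).map f ⊗ₘ (incl G R).map g : (⟨A ⊗ A'⟩ : Adjoin G R) ⟶ ⟨B ⊗ B'⟩) =
      (incl G R).map (f ⊗ₘ g) :=
  base_tensor f g

/-- The inclusion of `C` is a monoidal functor, all coherence morphisms being identities. -/
instance : (incl G R).Monoidal :=
  Functor.CoreMonoidal.toMonoidal
    { εIso := Iso.refl (⟨𝟙_ C⟩ : Adjoin G R)
      μIso := fun A B => Iso.refl (⟨A ⊗ B⟩ : Adjoin G R)
      μIso_hom_natural_left := fun {X Y} f X' => by
        refine (Category.comp_id _).trans (Eq.trans ?_ (Category.id_comp _).symm)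
        rw [← tensorHom_id, ← tensorHom_id]
        exact incl_tensor G R f (𝟙 X')
      μIso_hom_natural_right := fun {X Y} X' f => by
        refine (Category.comp_id _).trans (Eq.trans ?_ (Category.id_comp _).symm)
        rw [← id_tensorHom, ← id_tensorHom]
        exact incl_tensor G R (𝟙 X') f
      associativity := fun X Y Z => by
        let A : Adjoin G R := ⟨X⟩
        let B : Adjoin G R := ⟨Y⟩
        let E : Adjoin G R := ⟨Z⟩
        change (𝟙 (A ⊗ B)) ▷ E ≫ 𝟙 ((A ⊗ B) ⊗ E) ≫ (α_ A B E).hom =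
          (α_ A B E).hom ≫ A ◁ 𝟙 (B ⊗ E) ≫ 𝟙 (A ⊗ (B ⊗ E))
        simp
      left_unitality := fun X => by
        let A : Adjoin G R := ⟨X⟩
        change (λ_ A).hom = (𝟙 (𝟙_ (Adjoin G R))) ▷ A ≫ 𝟙 (𝟙_ (Adjoin G R) ⊗ A) ≫ (λ_ A).hom
        simp
      right_unitality := fun X => by
        let A : Adjoin G R := ⟨X⟩
        change (ρ_ A).hom = A ◁ (𝟙 (𝟙_ (Adjoin G R))) ≫ 𝟙 (A ⊗ 𝟙_ (Adjoin G R)) ≫ (ρ_ A).hom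
        simp }

instance : (incl G R).Braided where
  braided _ _ := (Category.id_comp _).trans (Category.comp_id _).symm

end Adjoin
end Adjoin

/-! ### The discard construction -/

section Discard

/-- The isometries: the morphisms `f` with `f† ∘ f = 1`. -/
def isometries (C : Type u) [Category.{v} C] [MonoidalCategory C] [SymmetricCategory C]
    [DaggerSMC C] : MorphismProperty C :=
  fun A _ f => f ≫ dagger f = 𝟙 A

variable (C : Type u) [Category.{v} C] [MonoidalCategory C] [SymmetricCategory C]

variable {C} in
theorem isometries_of_dagger_eq_inv [DaggerSMC C] {A B : C} (e : A ≅ B)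
    (h : dagger e.hom = e.inv) : isometries C e.hom ∧ isometries C e.inv := by
  refine ⟨by simp [isometries, h], ?_⟩
  have h' : dagger e.inv = e.hom := by rw [← h, DaggerSMC.dagger_dagger]
  simp [isometries, h']

variable {C} in
theorem dagger_braiding_eq_inv [DaggerSMC C] (A B : C) :
    dagger (β_ A B).hom = (β_ A B).inv := by
  rw [DaggerSMC.dagger_braiding, SymmetricCategory.braiding_swap_eq_inv_braiding]

instance [DaggerSMC C] : (isometries C).IsMultiplicative where
  id_mem A := by simp [isometries, DaggerSMC.dagger_id]
  comp_mem f g hf hg := by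
    simp only [isometries] at hf hg ⊢
    rw [DaggerSMC.dagger_comp, Category.assoc, reassoc_of% hg, hf]

/-- Isometries form a symmetric monoidal subcategory. -/
instance [DaggerSMC C] : (isometries C).IsStableUnderBraiding where
  toIsMonoidal := .mk' _ fun f g hf hg => by
    simp only [isometries] at hf hg ⊢
    rw [DaggerSMC.dagger_tensor, tensorHom_comp_tensorHom, hf, hg, id_tensorHom_id]
  associator_hom_mem A B E :=
    (isometries_of_dagger_eq_inv _ (DaggerSMC.dagger_associator A B E)).1
  associator_inv_mem A B E :=
    (isometries_of_dagger_eq_inv _ (DaggerSMC.dagger_associator A B E)).2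
  leftUnitor_hom_mem A := (isometries_of_dagger_eq_inv _ (DaggerSMC.dagger_leftUnitor A)).1
  leftUnitor_inv_mem A := (isometries_of_dagger_eq_inv _ (DaggerSMC.dagger_leftUnitor A)).2
  rightUnitor_hom_mem A := (isometries_of_dagger_eq_inv _ (DaggerSMC.dagger_rightUnitor A)).1
  rightUnitor_inv_mem A := (isometries_of_dagger_eq_inv _ (DaggerSMC.dagger_rightUnitor A)).2
  braiding_hom_mem A B := (isometries_of_dagger_eq_inv _ (dagger_braiding_eq_inv A B)).1
  braiding_inv_mem A B := (isometries_of_dagger_eq_inv _ (dagger_braiding_eq_inv A B)).2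

/-- The subcategory of isometries, with all objects. -/
abbrev IsometryCat [DaggerSMC C] := WideSubcategory (isometries C)

variable {C} in
/-- One new morphism `A ⟶ I` for each object `A`. -/
inductive AffineGen : C → C → Type u
  | discard (A : C) : AffineGen A (𝟙_ C)

variable {C} in
/-- The formal discard map of an object. -/
abbrev formalDiscard (A : C) : FormalHom AffineGen A (𝟙_ C) := .gen (.discard A)

/-- The equations making `I` terminal: `!_B ∘ f = !_A` for all `f : A ⟶ B` of `C^!`,
and `!_I = 1_I`. -/
inductive AffineRel :
    ∀ ⦃A B : C⦄, FormalHom (C := C) AffineGen A B → FormalHom AffineGen A B → Prop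
  | natural {A B : C} (f : FormalHom AffineGen A B) :
      AffineRel (f.comp (formalDiscard B)) (formalDiscard A)
  | unit : AffineRel (formalDiscard (𝟙_ C)) (.base (𝟙 (𝟙_ C)))

/-- The affine completion `C^!` of a symmetric monoidal category, which adjoins a map
`!_A : A ⟶ I` for every object `A`. -/
abbrev Affine := Adjoin (AffineGen (C := C)) (AffineRel C)

/-- The discard map `!_A` of the affine completion. -/
def Affine.discard (A : C) : (⟨A⟩ : Affine C) ⟶ ⟨𝟙_ C⟩ :=
  Adjoin.homMk (formalDiscard A)

variable [DaggerSMC C]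

variable {C} in
/-- The morphisms `A ⟶ B` of the affine completion of the category of isometries. -/
abbrev IsoAffineHom (A B : C) := (⟨⟨A⟩⟩ : Affine (IsometryCat C)) ⟶ ⟨⟨B⟩⟩

/-- The equations of `C^⏚`, besides those of `C`: the composites and tensor products of
`C_iso^!`, and the identification of an isometry in `C_iso^!` with the same isometry in `C`.
(The identities and structural morphisms of `C_iso^!` are isometries, so the last equation
identifies them with those of `C`.) -/
inductive DiscardRel : ∀ ⦃A B : C⦄,
    FormalHom (C := C) IsoAffineHom A B → FormalHom IsoAffineHom A B → Prop
  | comp {A B E : C} (f : IsoAffineHom A B) (g : IsoAffineHom B E) :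
      DiscardRel ((FormalHom.gen f).comp (.gen g)) (.gen (f ≫ g))
  | tensor {A B A' B' : C} (f : IsoAffineHom A B) (g : IsoAffineHom A' B') :
      DiscardRel ((FormalHom.gen f).tensor (.gen g))
        (.gen (f ⊗ₘ g : IsoAffineHom (A ⊗ A') (B ⊗ B')))
  | glue {A B : C} (u : (⟨A⟩ : IsometryCat C) ⟶ ⟨B⟩) :
      DiscardRel (.gen ((Adjoin.incl _ _).map u : IsoAffineHom A B)) (.base u.hom)

/-- The discard construction `C^⏚`: the pushout of `C` and `C_iso^!` along `C_iso`. Its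
objects are those of `C`; its morphisms are formal composites and tensor products of morphisms of
`C` and of `C_iso^!`, modulo the equations of both and the identification of the two copies of
each isometry. -/
abbrev DiscardCat := Adjoin (IsoAffineHom (C := C)) (DiscardRel C)

/-- The functor `C ⥤ C^⏚`. -/
abbrev DiscardCat.incl : C ⥤ DiscardCat C := Adjoin.incl _ _

variable {C} in
/-- The functor `C_iso^! ⥤ C^⏚`, on morphisms. -/
def DiscardCat.ofAffine {A B : C} (g : IsoAffineHom A B) :
    (DiscardCat.incl C).obj A ⟶ (DiscardCat.incl C).obj B :=
  Adjoin.homMk (FormalHom.gen (G := IsoAffineHom) g)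

/-- The discard map `⏚_A` of `C^⏚`, the image of `!_A`. -/
def DiscardCat.disc (A : C) : (DiscardCat.incl C).obj A ⟶ 𝟙_ (DiscardCat C) :=
  DiscardCat.ofAffine (Affine.discard (IsometryCat C) ⟨A⟩)

end Discard

/-! ### Finite-dimensional Hilbert spaces and qubits -/

/-- The Hilbert space `ℂ^n`. -/
abbrev HilbSpace (n : ℕ) := EuclideanSpace ℂ (Fin n)

/-- The identification `ℂ^m ⊗ ℂ^n = ℂ^(m n)` sending `e_i ⊗ e_j` to `e_(i n + j)`. -/
noncomputable def tensorEquiv (m n : ℕ) : HilbSpace m ⊗[ℂ] HilbSpace n ≃ₗᵢ[ℂ] HilbSpace (m * n) :=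
  (((EuclideanSpace.basisFun (Fin m) ℂ).tensorProduct
    (EuclideanSpace.basisFun (Fin n) ℂ)).reindex finProdFinEquiv).repr

/-- The identification `ℂ = ℂ^1`. -/
noncomputable def unitIso : ℂ ≃ₗᵢ[ℂ] HilbSpace 1 where
  toFun c := WithLp.toLp 2 fun _ => c
  invFun t := t 0
  map_add' _ _ := rfl
  map_smul' _ _ := rfl
  left_inv _ := rfl
  right_inv t := by ext i; simp [Subsingleton.elim i 0]
  norm_map' c := by
    rw [EuclideanSpace.norm_eq]
    simp only [Finset.univ_unique, Finset.sum_singleton]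
    exact Real.sqrt_sq (norm_nonneg c)

/-- The category `FHilb` has one object `ℂ^n` for each natural number `n`. -/
@[ext]
structure FHilb where
  /-- The dimension. -/
  dim : ℕ

namespace FHilb

/-- The Hilbert space `ℂ^n`. -/
abbrev space (A : FHilb) := HilbSpace A.dim

/-- Morphisms are linear maps. -/
@[ext]
structure Hom (A B : FHilb) where
  /-- The underlying linear map. -/
  lin : A.space →ₗ[ℂ] B.space

instance : Category FHilb where
  Hom := Hom
  id A := ⟨LinearMap.id⟩
  comp f g := ⟨g.lin ∘ₗ f.lin⟩

@[ext]
theorem hom_ext {A B : FHilb} {f g : A ⟶ B} (h : f.lin = g.lin) : f = g := Hom.ext h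

@[simp] theorem id_lin (A : FHilb) : Hom.lin (𝟙 A) = LinearMap.id := rfl
@[simp] theorem comp_lin {A B E : FHilb} (f : A ⟶ B) (g : B ⟶ E) :
    (f ≫ g).lin = g.lin ∘ₗ f.lin := rfl

/-- A unitary map, as an isomorphism. -/
noncomputable def isoOfUnitary {A B : FHilb} (e : A.space ≃ₗᵢ[ℂ] B.space) : A ≅ B where
  hom := ⟨e.toLinearEquiv.toLinearMap⟩
  inv := ⟨e.symm.toLinearEquiv.toLinearMap⟩
  hom_inv_id := by ext1; ext1 x; simp
  inv_hom_id := by ext1; ext1 x; simp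

/-- The tensor product of linear maps. -/
noncomputable def tensorLin {a b a' b' : ℕ} (f : HilbSpace a →ₗ[ℂ] HilbSpace b)
    (g : HilbSpace a' →ₗ[ℂ] HilbSpace b') : HilbSpace (a * a') →ₗ[ℂ] HilbSpace (b * b') :=
  (tensorEquiv b b').toLinearEquiv.toLinearMap ∘ₗ TensorProduct.map f g ∘ₗ
    (tensorEquiv a a').symm.toLinearEquiv.toLinearMap

@[simp] theorem tensorLin_apply {a b a' b' : ℕ} (f : HilbSpace a →ₗ[ℂ] HilbSpace b)
    (g : HilbSpace a' →ₗ[ℂ] HilbSpace b') (x : HilbSpace a) (y : HilbSpace a') :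
    tensorLin f g (tensorEquiv a a' (x ⊗ₜ y)) = tensorEquiv b b' (f x ⊗ₜ g y) := by
  simp [tensorLin]

theorem lin_ext {a b n : ℕ} {f g : HilbSpace (a * b) →ₗ[ℂ] HilbSpace n}
    (h : ∀ x y, f (tensorEquiv a b (x ⊗ₜ y)) = g (tensorEquiv a b (x ⊗ₜ y))) : f = g := by
  have : f ∘ₗ (tensorEquiv a b).toLinearEquiv.toLinearMap =
      g ∘ₗ (tensorEquiv a b).toLinearEquiv.toLinearMap :=
    TensorProduct.ext' fun x y => h x y
  ext1 z
  simpa using congrArg (fun k => k ((tensorEquiv a b).symm z)) this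

theorem lin_ext₃ {a b c n : ℕ} {f g : HilbSpace (a * b * c) →ₗ[ℂ] HilbSpace n}
    (h : ∀ x y z, f (tensorEquiv _ c (tensorEquiv a b (x ⊗ₜ y) ⊗ₜ z)) =
      g (tensorEquiv _ c (tensorEquiv a b (x ⊗ₜ y) ⊗ₜ z))) : f = g := by
  refine lin_ext fun w z => ?_
  have : f ∘ₗ (tensorEquiv _ c).toLinearEquiv.toLinearMap ∘ₗ (TensorProduct.mk ℂ _ _).flip z =
      g ∘ₗ (tensorEquiv _ c).toLinearEquiv.toLinearMap ∘ₗ (TensorProduct.mk ℂ _ _).flip z :=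
    lin_ext fun x y => h x y z
  exact congrArg (fun k => k w) this

theorem lin_ext₃' {a b c n : ℕ} {f g : HilbSpace (a * (b * c)) →ₗ[ℂ] HilbSpace n}
    (h : ∀ x y z, f (tensorEquiv a _ (x ⊗ₜ tensorEquiv b c (y ⊗ₜ z))) =
      g (tensorEquiv a _ (x ⊗ₜ tensorEquiv b c (y ⊗ₜ z)))) : f = g := by
  refine lin_ext fun x w => ?_
  have : f ∘ₗ (tensorEquiv a _).toLinearEquiv.toLinearMap ∘ₗ TensorProduct.mk ℂ _ _ x =
      g ∘ₗ (tensorEquiv a _).toLinearEquiv.toLinearMap ∘ₗ TensorProduct.mk ℂ _ _ x :=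
    lin_ext fun y z => h x y z
  exact congrArg (fun k => k w) this

theorem lin_ext₄ {a b c d n : ℕ} {f g : HilbSpace (a * b * c * d) →ₗ[ℂ] HilbSpace n}
    (h : ∀ x y z w, f (tensorEquiv _ d (tensorEquiv _ c (tensorEquiv a b (x ⊗ₜ y) ⊗ₜ z) ⊗ₜ w)) =
      g (tensorEquiv _ d (tensorEquiv _ c (tensorEquiv a b (x ⊗ₜ y) ⊗ₜ z) ⊗ₜ w))) : f = g := by
  refine lin_ext fun v w => ?_
  have : f ∘ₗ (tensorEquiv _ d).toLinearEquiv.toLinearMap ∘ₗ (TensorProduct.mk ℂ _ _).flip w =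
      g ∘ₗ (tensorEquiv _ d).toLinearEquiv.toLinearMap ∘ₗ (TensorProduct.mk ℂ _ _).flip w :=
    lin_ext₃ fun x y z => h x y z w
  exact congrArg (fun k => k v) this

open TensorProduct in
/-- The associator of Hilbert spaces, on `ℂ^((a b) c)`. -/
noncomputable def assocIso (a b c : ℕ) : HilbSpace (a * b * c) ≃ₗᵢ[ℂ] HilbSpace (a * (b * c)) :=
  (tensorEquiv (a * b) c).symm.trans <|
    (congrIsometry (tensorEquiv a b).symm (.refl ℂ (HilbSpace c))).trans <|
    (assocIsometry ℂ (HilbSpace a) (HilbSpace b) (HilbSpace c)).trans <|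
    (congrIsometry (.refl ℂ (HilbSpace a)) (tensorEquiv b c)).trans (tensorEquiv a (b * c))

/-- The left unitor of Hilbert spaces, on `ℂ^(1 a)`. -/
noncomputable def leftIso (a : ℕ) : HilbSpace (1 * a) ≃ₗᵢ[ℂ] HilbSpace a :=
  (tensorEquiv 1 a).symm.trans <|
    (TensorProduct.congrIsometry unitIso.symm (.refl ℂ (HilbSpace a))).trans <|
    TensorProduct.lidIsometry ℂ (HilbSpace a)

/-- The right unitor of Hilbert spaces, on `ℂ^(a 1)`. -/
noncomputable def rightIso (a : ℕ) : HilbSpace (a * 1) ≃ₗᵢ[ℂ] HilbSpace a :=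
  (tensorEquiv a 1).symm.trans <|
    (TensorProduct.congrIsometry (.refl ℂ (HilbSpace a)) unitIso.symm).trans <|
    TensorProduct.ridIsometry ℂ (HilbSpace a)

/-- The swap of Hilbert spaces, on `ℂ^(a b)`. -/
noncomputable def swapIso (a b : ℕ) : HilbSpace (a * b) ≃ₗᵢ[ℂ] HilbSpace (b * a) :=
  (tensorEquiv a b).symm.trans <|
    (TensorProduct.commIsometry ℂ (HilbSpace a) (HilbSpace b)).trans (tensorEquiv b a)

@[simp] theorem assocIso_apply {a b c : ℕ} (x : HilbSpace a) (y : HilbSpace b) (z : HilbSpace c) :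
    assocIso a b c (tensorEquiv _ c (tensorEquiv a b (x ⊗ₜ y) ⊗ₜ z)) =
      tensorEquiv a _ (x ⊗ₜ tensorEquiv b c (y ⊗ₜ z)) := by
  simp [assocIso]

@[simp] theorem assocIso_symm_apply {a b c : ℕ} (x : HilbSpace a) (y : HilbSpace b) (z : HilbSpace c) :
    (assocIso a b c).symm (tensorEquiv a _ (x ⊗ₜ tensorEquiv b c (y ⊗ₜ z))) =
      tensorEquiv _ c (tensorEquiv a b (x ⊗ₜ y) ⊗ₜ z) := by
  rw [LinearIsometryEquiv.symm_apply_eq, assocIso_apply]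

@[simp] theorem leftIso_apply {a : ℕ} (t : HilbSpace 1) (x : HilbSpace a) :
    leftIso a (tensorEquiv 1 a (t ⊗ₜ x)) = unitIso.symm t • x := by
  simp [leftIso]

@[simp] theorem rightIso_apply {a : ℕ} (t : HilbSpace 1) (x : HilbSpace a) :
    rightIso a (tensorEquiv a 1 (x ⊗ₜ t)) = unitIso.symm t • x := by
  simp [rightIso]

@[simp] theorem swapIso_apply {a b : ℕ} (x : HilbSpace a) (y : HilbSpace b) :
    swapIso a b (tensorEquiv a b (x ⊗ₜ y)) = tensorEquiv b a (y ⊗ₜ x) := by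
  simp [swapIso]

noncomputable instance : MonoidalCategoryStruct FHilb where
  tensorObj A B := ⟨A.dim * B.dim⟩
  tensorUnit := ⟨1⟩
  tensorHom f g := ⟨tensorLin f.lin g.lin⟩
  whiskerLeft _ _ _ f := ⟨tensorLin LinearMap.id f.lin⟩
  whiskerRight f _ := ⟨tensorLin f.lin LinearMap.id⟩
  associator A B E := isoOfUnitary (assocIso A.dim B.dim E.dim)
  leftUnitor A := isoOfUnitary (leftIso A.dim)
  rightUnitor A := isoOfUnitary (rightIso A.dim)

theorem tensorLin_id (a b : ℕ) :
    tensorLin (LinearMap.id : HilbSpace a →ₗ[ℂ] _) (LinearMap.id : HilbSpace b →ₗ[ℂ] _) =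
      LinearMap.id :=
  lin_ext fun x y => by simp

theorem tensorLin_comp {a b c a' b' c' : ℕ} (f : HilbSpace a →ₗ[ℂ] HilbSpace b)
    (f' : HilbSpace a' →ₗ[ℂ] HilbSpace b') (g : HilbSpace b →ₗ[ℂ] HilbSpace c)
    (g' : HilbSpace b' →ₗ[ℂ] HilbSpace c') :
    tensorLin g g' ∘ₗ tensorLin f f' = tensorLin (g ∘ₗ f) (g' ∘ₗ f') :=
  lin_ext fun x y => by simp

theorem assoc_naturality {a b c a' b' c' : ℕ} (f : HilbSpace a →ₗ[ℂ] HilbSpace a')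
    (g : HilbSpace b →ₗ[ℂ] HilbSpace b') (h : HilbSpace c →ₗ[ℂ] HilbSpace c') :
    (assocIso a' b' c').toLinearEquiv.toLinearMap ∘ₗ tensorLin (tensorLin f g) h =
      tensorLin f (tensorLin g h) ∘ₗ (assocIso a b c).toLinearEquiv.toLinearMap :=
  lin_ext₃ fun x y z => by simp

theorem left_naturality {a b : ℕ} (f : HilbSpace a →ₗ[ℂ] HilbSpace b) :
    (leftIso b).toLinearEquiv.toLinearMap ∘ₗ tensorLin LinearMap.id f =
      f ∘ₗ (leftIso a).toLinearEquiv.toLinearMap :=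
  lin_ext fun x y => by simp

theorem right_naturality {a b : ℕ} (f : HilbSpace a →ₗ[ℂ] HilbSpace b) :
    (rightIso b).toLinearEquiv.toLinearMap ∘ₗ tensorLin f LinearMap.id =
      f ∘ₗ (rightIso a).toLinearEquiv.toLinearMap :=
  lin_ext fun x y => by simp

theorem swap_naturality {a b a' b' : ℕ} (f : HilbSpace a →ₗ[ℂ] HilbSpace a')
    (g : HilbSpace b →ₗ[ℂ] HilbSpace b') :
    (swapIso a' b').toLinearEquiv.toLinearMap ∘ₗ tensorLin f g =
      tensorLin g f ∘ₗ (swapIso a b).toLinearEquiv.toLinearMap :=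
  lin_ext fun x y => by simp

theorem pentagon_lin (a b c d : ℕ) :
    (tensorLin LinearMap.id (assocIso b c d).toLinearEquiv.toLinearMap ∘ₗ
      (assocIso a (b * c) d).toLinearEquiv.toLinearMap) ∘ₗ
        tensorLin (assocIso a b c).toLinearEquiv.toLinearMap LinearMap.id =
      (assocIso a b (c * d)).toLinearEquiv.toLinearMap ∘ₗ
        (assocIso (a * b) c d).toLinearEquiv.toLinearMap :=
  lin_ext₄ fun x y z w => by simp

theorem triangle_lin (a b : ℕ) :
    tensorLin LinearMap.id (leftIso b).toLinearEquiv.toLinearMap ∘ₗ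
      (assocIso a 1 b).toLinearEquiv.toLinearMap =
      tensorLin (rightIso a).toLinearEquiv.toLinearMap LinearMap.id :=
  lin_ext₃ fun x t y => by simp [TensorProduct.smul_tmul]

theorem hexagon_lin (a b c : ℕ) :
    ((assocIso b c a).toLinearEquiv.toLinearMap ∘ₗ
      (swapIso a (b * c)).toLinearEquiv.toLinearMap) ∘ₗ
        (assocIso a b c).toLinearEquiv.toLinearMap =
      (tensorLin LinearMap.id (swapIso a c).toLinearEquiv.toLinearMap ∘ₗ
        (assocIso b a c).toLinearEquiv.toLinearMap) ∘ₗ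
          tensorLin (swapIso a b).toLinearEquiv.toLinearMap LinearMap.id :=
  lin_ext₃ fun x y z => by simp

theorem hexagon_lin' (a b c : ℕ) :
    ((assocIso c a b).symm.toLinearEquiv.toLinearMap ∘ₗ
      (swapIso (a * b) c).toLinearEquiv.toLinearMap) ∘ₗ
        (assocIso a b c).symm.toLinearEquiv.toLinearMap =
      (tensorLin (swapIso a c).toLinearEquiv.toLinearMap LinearMap.id ∘ₗ
        (assocIso a c b).symm.toLinearEquiv.toLinearMap) ∘ₗ
          tensorLin LinearMap.id (swapIso b c).toLinearEquiv.toLinearMap :=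
  lin_ext₃' fun x y z => by simp

theorem swap_swap (a b : ℕ) :
    (swapIso b a).toLinearEquiv.toLinearMap ∘ₗ (swapIso a b).toLinearEquiv.toLinearMap =
      LinearMap.id :=
  lin_ext fun x y => by simp

attribute [local irreducible] tensorLin assocIso leftIso rightIso swapIso

noncomputable instance : MonoidalCategory FHilb :=
  MonoidalCategory.ofTensorHom
    (id_tensorHom_id := fun A B => hom_ext (tensorLin_id A.dim B.dim))
    (id_tensorHom := fun _ _ _ _ => rfl)
    (tensorHom_id := fun _ _ => rfl)
    (tensorHom_comp_tensorHom := fun f₁ f₂ g₁ g₂ =>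
      hom_ext (tensorLin_comp f₁.lin f₂.lin g₁.lin g₂.lin))
    (associator_naturality := fun f g h => hom_ext (assoc_naturality f.lin g.lin h.lin))
    (leftUnitor_naturality := fun f => hom_ext (left_naturality f.lin))
    (rightUnitor_naturality := fun f => hom_ext (right_naturality f.lin))
    (pentagon := fun W X Y Z => hom_ext (pentagon_lin W.dim X.dim Y.dim Z.dim))
    (triangle := fun X Y => hom_ext (triangle_lin X.dim Y.dim))

noncomputable instance : SymmetricCategory FHilb where
  braiding A B := isoOfUnitary (swapIso A.dim B.dim)
  braiding_naturality_right A _ _ f :=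
    hom_ext (swap_naturality (LinearMap.id : A.space →ₗ[ℂ] A.space) f.lin)
  braiding_naturality_left f A :=
    hom_ext (swap_naturality f.lin (LinearMap.id : A.space →ₗ[ℂ] A.space))
  hexagon_forward A B E := hom_ext (hexagon_lin A.dim B.dim E.dim)
  hexagon_reverse A B E := hom_ext (hexagon_lin' A.dim B.dim E.dim)
  symmetry A B := hom_ext (swap_swap A.dim B.dim)

theorem adjoint_tensorLin {a b a' b' : ℕ} (f : HilbSpace a →ₗ[ℂ] HilbSpace b)
    (g : HilbSpace a' →ₗ[ℂ] HilbSpace b') :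
    LinearMap.adjoint (tensorLin f g) = tensorLin (LinearMap.adjoint f) (LinearMap.adjoint g) := by
  have h1 : LinearMap.adjoint (tensorEquiv b b').toLinearEquiv.toLinearMap =
    (tensorEquiv b b').symm.toLinearEquiv.toLinearMap := (tensorEquiv b b').adjoint_toLinearMap_eq_symm
  have h2 : LinearMap.adjoint (tensorEquiv a a').symm.toLinearEquiv.toLinearMap =
    (tensorEquiv a a').toLinearEquiv.toLinearMap := (tensorEquiv a a').symm.adjoint_toLinearMap_eq_symm
  simp only [tensorLin, LinearMap.adjoint_comp, h1, h2, TensorProduct.adjoint_map,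
    LinearMap.comp_assoc]

theorem swapIso_symm (a b : ℕ) : (swapIso a b).symm = swapIso b a := by
  ext1 z
  rw [LinearIsometryEquiv.symm_apply_eq]
  exact (congrArg (fun k => k z) (swap_swap b a)).symm

theorem adjoint_isometry {a b : ℕ} (e : HilbSpace a ≃ₗᵢ[ℂ] HilbSpace b) :
    LinearMap.adjoint e.toLinearEquiv.toLinearMap = e.symm.toLinearEquiv.toLinearMap :=
  e.adjoint_toLinearMap_eq_symm

/-- The dagger is the adjoint. -/
noncomputable instance : DaggerSMC FHilb where
  dagger f := ⟨LinearMap.adjoint f.lin⟩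
  dagger_dagger f := hom_ext (LinearMap.adjoint_adjoint f.lin)
  dagger_id A := hom_ext LinearMap.adjoint_id
  dagger_comp f g := hom_ext (LinearMap.adjoint_comp g.lin f.lin)
  dagger_tensor f g := hom_ext (adjoint_tensorLin f.lin g.lin)
  dagger_associator A B E := hom_ext (adjoint_isometry _)
  dagger_leftUnitor A := hom_ext (adjoint_isometry _)
  dagger_rightUnitor A := hom_ext (adjoint_isometry _)
  dagger_braiding A B := hom_ext ((adjoint_isometry _).trans (by rw [swapIso_symm]; rfl))

theorem tensorEquiv_apply {a b : ℕ} (x : HilbSpace a) (y : HilbSpace b) (k : Fin (a * b)) :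
    tensorEquiv a b (x ⊗ₜ y) k = x k.divNat * y k.modNat := by
  refine Eq.trans ?_ (mul_comm (y k.modNat) (x k.divNat))
  simp [tensorEquiv, finProdFinEquiv]

theorem unitIso_symm_apply (t : HilbSpace 1) : unitIso.symm t = t 0 := rfl

theorem eqToHom_lin_apply {A B : FHilb} (h : A = B) (x : A.space) (i : Fin B.dim) :
    (eqToHom h).lin x i = x (Fin.cast (by rw [h]) i) := by
  subst h; rfl

theorem strict_assoc (a b c : ℕ) (w : HilbSpace (a * b * c)) (i : Fin (a * (b * c))) :
    assocIso a b c w i = w (Fin.cast (mul_assoc a b c).symm i) := by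
  let p : HilbSpace (a * b * c) →ₗ[ℂ] HilbSpace (a * (b * c)) :=
    { toFun := fun w => WithLp.toLp 2 fun i => w (Fin.cast (mul_assoc a b c).symm i)
      map_add' := fun _ _ => rfl
      map_smul' := fun _ _ => rfl }
  have h : (assocIso a b c).toLinearEquiv.toLinearMap = p := by
    refine lin_ext₃ fun x y z => ?_
    ext i
    change assocIso a b c _ i = tensorEquiv (a * b) c _ (Fin.cast (mul_assoc a b c).symm i)
    rw [assocIso_apply]
    simp only [tensorEquiv_apply]
    have h1 : (Fin.cast (mul_assoc a b c).symm i).divNat.divNat = i.divNat :=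
      Fin.ext (by simp [Fin.divNat, Nat.div_div_eq_div_mul, mul_comm])
    have h2 : (Fin.cast (mul_assoc a b c).symm i).divNat.modNat = i.modNat.divNat :=
      Fin.ext (by simp [Fin.divNat, Fin.modNat, Nat.mod_mul_left_div_self])
    have h3 : (Fin.cast (mul_assoc a b c).symm i).modNat = i.modNat.modNat :=
      Fin.ext (by simp [Fin.modNat])
    rw [h1, h2, h3, mul_assoc]
  exact congrArg (fun k => k w i) h

theorem strict_left (a : ℕ) (w : HilbSpace (1 * a)) (i : Fin a) :
    leftIso a w i = w (Fin.cast (one_mul a).symm i) := by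
  let p : HilbSpace (1 * a) →ₗ[ℂ] HilbSpace a :=
    { toFun := fun w => WithLp.toLp 2 fun i => w (Fin.cast (one_mul a).symm i)
      map_add' := fun _ _ => rfl
      map_smul' := fun _ _ => rfl }
  have h : (leftIso a).toLinearEquiv.toLinearMap = p := by
    refine lin_ext fun t x => ?_
    ext i
    change leftIso a _ i = tensorEquiv 1 a _ (Fin.cast (one_mul a).symm i)
    rw [leftIso_apply, tensorEquiv_apply, unitIso_symm_apply]
    have h1 : (Fin.cast (one_mul a).symm i).modNat = i :=
      Fin.ext (by simp [Fin.modNat, Nat.mod_eq_of_lt i.isLt])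
    rw [h1, Subsingleton.elim (Fin.cast (one_mul a).symm i).divNat 0]
    rfl
  exact congrArg (fun k => k w i) h

theorem strict_right (a : ℕ) (w : HilbSpace (a * 1)) (i : Fin a) :
    rightIso a w i = w (Fin.cast (mul_one a).symm i) := by
  let p : HilbSpace (a * 1) →ₗ[ℂ] HilbSpace a :=
    { toFun := fun w => WithLp.toLp 2 fun i => w (Fin.cast (mul_one a).symm i)
      map_add' := fun _ _ => rfl
      map_smul' := fun _ _ => rfl }
  have h : (rightIso a).toLinearEquiv.toLinearMap = p := by
    refine lin_ext fun x t => ?_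
    ext i
    change rightIso a _ i = tensorEquiv a 1 _ (Fin.cast (mul_one a).symm i)
    rw [rightIso_apply, tensorEquiv_apply, unitIso_symm_apply]
    have h1 : (Fin.cast (mul_one a).symm i).divNat = i := Fin.ext (by simp [Fin.divNat])
    rw [h1, Subsingleton.elim (Fin.cast (mul_one a).symm i).modNat 0]
    exact mul_comm _ _
  exact congrArg (fun k => k w i) h

instance : IsStrictMonoidal FHilb where
  associator_eq A B E := by
    have h : (A ⊗ B) ⊗ E = A ⊗ (B ⊗ E) := FHilb.ext (mul_assoc A.dim B.dim E.dim)
    refine ⟨h, hom_ext (LinearMap.ext fun w => PiLp.ext fun i => ?_)⟩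
    exact (strict_assoc _ _ _ w i).trans (eqToHom_lin_apply h w i).symm
  leftUnitor_eq A := by
    have h : 𝟙_ FHilb ⊗ A = A := FHilb.ext (one_mul A.dim)
    refine ⟨h, hom_ext (LinearMap.ext fun w => PiLp.ext fun i => ?_)⟩
    exact (strict_left _ w i).trans (eqToHom_lin_apply h w i).symm
  rightUnitor_eq A := by
    have h : A ⊗ 𝟙_ FHilb = A := FHilb.ext (mul_one A.dim)
    refine ⟨h, hom_ext (LinearMap.ext fun w => PiLp.ext fun i => ?_)⟩
    exact (strict_right _ w i).trans (eqToHom_lin_apply h w i).symm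

/-- The vector `∑ i, e_i ⊗ e_i`. -/
noncomputable def capVector (a : ℕ) : HilbSpace (a * a) :=
  ∑ i, tensorEquiv a a (EuclideanSpace.single i 1 ⊗ₜ EuclideanSpace.single i 1)

/-- The linear map `ℂ ⟶ ℂ^a ⊗ ℂ^a`, `1 ↦ ∑ i, e_i ⊗ e_i`. -/
noncomputable def capLin (a : ℕ) : HilbSpace 1 →ₗ[ℂ] HilbSpace (a * a) :=
  (LinearMap.toSpanSingleton ℂ _ (capVector a)) ∘ₗ unitIso.symm.toLinearEquiv.toLinearMap

/-- The linear map `ℂ^a ⊗ ℂ^a ⟶ ℂ`, `e_i ⊗ e_j ↦ δ_ij`. -/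
noncomputable def cupLin (a : ℕ) : HilbSpace (a * a) →ₗ[ℂ] HilbSpace 1 :=
  LinearMap.adjoint (capLin a)

theorem capLin_apply {a : ℕ} (t : HilbSpace 1) : capLin a t = unitIso.symm t • capVector a := rfl

theorem cupLin_apply {a : ℕ} (x y : HilbSpace a) :
    cupLin a (tensorEquiv a a (x ⊗ₜ y)) = unitIso (∑ i, x i * y i) := by
  refine ext_inner_left ℂ fun t => ?_
  rw [cupLin, LinearMap.adjoint_inner_right, capLin_apply, inner_smul_left, capVector, sum_inner,
    ← unitIso.symm.inner_map_map t]
  simp [EuclideanSpace.inner_single_left, mul_comm]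

theorem cap_swap (a : ℕ) :
    (swapIso a a).toLinearEquiv.toLinearMap ∘ₗ capLin a = capLin a := by
  ext1 t
  simp [capLin_apply, capVector]

theorem leftIso_symm_apply {a : ℕ} (x : HilbSpace a) :
    (leftIso a).symm x = tensorEquiv 1 a (unitIso 1 ⊗ₜ x) := by
  rw [LinearIsometryEquiv.symm_apply_eq]; simp

theorem rightIso_symm_apply {a : ℕ} (x : HilbSpace a) :
    (rightIso a).symm x = tensorEquiv a 1 (x ⊗ₜ unitIso 1) := by
  rw [LinearIsometryEquiv.symm_apply_eq]; simp

theorem sum_single {a : ℕ} (x : HilbSpace a) :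
    x = ∑ i, x i • EuclideanSpace.single i (1 : ℂ) := by
  ext j
  simp [Pi.single_apply]

theorem sum_mul_single {a : ℕ} (x : HilbSpace a) (i : Fin a) :
    ∑ j, x j * (EuclideanSpace.single i (1 : ℂ) : HilbSpace a) j = x i := by
  simp

theorem sum_single_mul {a : ℕ} (x : HilbSpace a) (i : Fin a) :
    ∑ j, (EuclideanSpace.single i (1 : ℂ) : HilbSpace a) j * x j = x i := by
  simp

theorem unitIso_eq (c : ℂ) : unitIso c = c • unitIso 1 := by
  rw [← map_smul]; simp

theorem snake_lin (a : ℕ) :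
    (tensorLin (cupLin a) LinearMap.id ∘ₗ (assocIso a a a).symm.toLinearEquiv.toLinearMap) ∘ₗ
      tensorLin LinearMap.id (capLin a) =
    (leftIso a).symm.toLinearEquiv.toLinearMap ∘ₗ (rightIso a).toLinearEquiv.toLinearMap :=
  lin_ext fun x t => by
    simp only [LinearMap.comp_apply, LinearEquiv.coe_coe, LinearIsometryEquiv.coe_toLinearEquiv,
      tensorLin_apply, LinearMap.id_apply, capLin_apply, capVector, TensorProduct.tmul_smul,
      TensorProduct.tmul_sum, map_smul, map_sum, assocIso_symm_apply, rightIso_apply,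
      leftIso_symm_apply, cupLin_apply]
    congr 1
    conv_rhs => rw [sum_single x]
    simp only [TensorProduct.tmul_sum, map_sum]
    refine Finset.sum_congr rfl fun i _ => ?_
    rw [← map_sum unitIso, sum_mul_single, unitIso_eq, TensorProduct.smul_tmul]

theorem snake_lin' (a : ℕ) :
    (tensorLin LinearMap.id (cupLin a) ∘ₗ (assocIso a a a).toLinearEquiv.toLinearMap) ∘ₗ
      tensorLin (capLin a) LinearMap.id =
    (rightIso a).symm.toLinearEquiv.toLinearMap ∘ₗ (leftIso a).toLinearEquiv.toLinearMap :=
  lin_ext fun t x => by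
    simp only [LinearMap.comp_apply, LinearEquiv.coe_coe, LinearIsometryEquiv.coe_toLinearEquiv,
      tensorLin_apply, LinearMap.id_apply, capLin_apply, capVector, ← TensorProduct.smul_tmul',
      TensorProduct.sum_tmul, map_smul, map_sum, assocIso_apply, leftIso_apply,
      rightIso_symm_apply, cupLin_apply]
    congr 1
    conv_rhs => rw [sum_single x]
    simp only [TensorProduct.sum_tmul, map_sum]
    refine Finset.sum_congr rfl fun i _ => ?_
    rw [← map_sum unitIso, sum_single_mul, unitIso_eq, ← TensorProduct.smul_tmul]

attribute [local irreducible] capLin cupLin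

/-- `ℂ^n` is its own dual. -/
noncomputable instance (A : FHilb) : ExactPairing A A where
  coevaluation' := ⟨capLin A.dim⟩
  evaluation' := ⟨cupLin A.dim⟩
  coevaluation_evaluation' := hom_ext (snake_lin A.dim)
  evaluation_coevaluation' := hom_ext (snake_lin' A.dim)

theorem adjoint_cup (a : ℕ) : LinearMap.adjoint (cupLin a) = capLin a := by
  simp [cupLin]

instance : IsDaggerCompact FHilb where
  exists_dual A := ⟨A, inferInstance, hom_ext ((adjoint_cup A.dim).trans (cap_swap A.dim).symm)⟩

end FHilb

/-! ### Qubits -/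

/-- The spaces `ℂ^(2^n)`. -/
def isQubitSpace : ObjectProperty FHilb := fun A => ∃ n : ℕ, A.dim = 2 ^ n

instance : isQubitSpace.IsMonoidal where
  prop_unit := ⟨0, rfl⟩
  prop_tensor := by
    rintro A B ⟨m, hm⟩ ⟨n, hn⟩
    exact ⟨m + n, by rw [pow_add, ← hm, ← hn]; rfl⟩

/-- `Qubit` is the full subcategory of `FHilb` on the spaces `ℂ^(2^n)`, with the tensor product,
symmetry and dagger of `FHilb`. -/
abbrev Qubit := isQubitSpace.FullSubcategory

namespace Qubit

noncomputable instance : DaggerSMC Qubit where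
  dagger f := ObjectProperty.homMk (dagger f.hom)
  dagger_dagger f := ObjectProperty.hom_ext _ (DaggerSMC.dagger_dagger f.hom)
  dagger_id A := ObjectProperty.hom_ext _ (DaggerSMC.dagger_id A.obj)
  dagger_comp f g := ObjectProperty.hom_ext _ (DaggerSMC.dagger_comp f.hom g.hom)
  dagger_tensor f g := ObjectProperty.hom_ext _ (DaggerSMC.dagger_tensor f.hom g.hom)
  dagger_associator A B E :=
    ObjectProperty.hom_ext _ (DaggerSMC.dagger_associator A.obj B.obj E.obj)
  dagger_leftUnitor A := ObjectProperty.hom_ext _ (DaggerSMC.dagger_leftUnitor A.obj)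
  dagger_rightUnitor A := ObjectProperty.hom_ext _ (DaggerSMC.dagger_rightUnitor A.obj)
  dagger_braiding A B := ObjectProperty.hom_ext _ (DaggerSMC.dagger_braiding A.obj B.obj)

theorem eqToHom_hom {A B : Qubit} (h : A = B) :
    (eqToHom h).hom = eqToHom (congrArg ObjectProperty.FullSubcategory.obj h) := by
  subst h; rfl

instance : IsStrictMonoidal Qubit where
  associator_eq A B E := by
    obtain ⟨h, e⟩ := IsStrictMonoidal.associator_eq A.obj B.obj E.obj
    have h' : (A ⊗ B) ⊗ E = A ⊗ (B ⊗ E) := ObjectProperty.FullSubcategory.ext h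
    exact ⟨h', ObjectProperty.hom_ext _ (e.trans (eqToHom_hom h').symm)⟩
  leftUnitor_eq A := by
    obtain ⟨h, e⟩ := IsStrictMonoidal.leftUnitor_eq A.obj
    have h' : 𝟙_ Qubit ⊗ A = A := ObjectProperty.FullSubcategory.ext h
    exact ⟨h', ObjectProperty.hom_ext _ (e.trans (eqToHom_hom h').symm)⟩
  rightUnitor_eq A := by
    obtain ⟨h, e⟩ := IsStrictMonoidal.rightUnitor_eq A.obj
    have h' : A ⊗ 𝟙_ Qubit = A := ObjectProperty.FullSubcategory.ext h
    exact ⟨h', ObjectProperty.hom_ext _ (e.trans (eqToHom_hom h').symm)⟩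

noncomputable instance (A : Qubit) : ExactPairing A A where
  coevaluation' := ObjectProperty.homMk (η_ A.obj A.obj)
  evaluation' := ObjectProperty.homMk (ε_ A.obj A.obj)
  coevaluation_evaluation' :=
    ObjectProperty.hom_ext _ (ExactPairing.coevaluation_evaluation A.obj A.obj)
  evaluation_coevaluation' :=
    ObjectProperty.hom_ext _ (ExactPairing.evaluation_coevaluation A.obj A.obj)

instance : IsDaggerCompact Qubit where
  exists_dual A := ⟨A, inferInstance, ObjectProperty.hom_ext _ (FHilb.hom_ext
    ((FHilb.adjoint_cup A.obj.dim).trans (FHilb.cap_swap A.obj.dim).symm))⟩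

end Qubit

/-! Everything except the condition on `∼cp` is formal and holds for any dagger compact category
`C`. Structural morphisms and duals of `C^⏚` are the images of those of `C`. Morphisms of the form
`(1 ⊗ ⏚) ∘ ι f` include all generators and are closed under composition and tensor, because discards
can be pushed to the end and merged; so every morphism has a purification (`IsPurified.homMk`).

For `∼cp`, put `E_f((y,y'),(x,x')) = ∑ i, f((y,i),x) * conj (f((y',i),x'))`, the matrix of the
completely positive map obtained from `f` by tracing out `X`. Its entries are, up to rearrangement,
those of `cpDiagram f` (`mat_cpDiagram`), so `f ∼cp g` means `E_f = E_g`.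

Equality in `C^⏚` implies `E_f = E_g`: sending `f` to `f ⊗ f̄` and `⏚` to the trace respects every
defining relation of `C^⏚`, since isometries preserve the trace, and it sends `(1 ⊗ ⏚) ∘ ι f` to
`E_f` (`evalDiscard_discardOutput`).

Conversely, `E_f` is the Gram matrix of the vectors `(⟨y| ⊗ 1) f |x⟩` of `X`. If `E_f = E_g`, embed
`X` and `Y` isometrically into `X ⊗ Y`, which is large enough because the dimensions are powers of
two and hence nonzero. The two families then have the same Gram matrix in one finite-dimensional
space, so an isometry carries one to the other. This gives isometries `r`, `s` with `(1 ⊗ r) f = (1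
⊗ s) g` (`exists_isometries_of_gram_eq`), and discarding absorbs `r` and `s`
(`discardOutput_eq_of_isometries`). -/

open scoped Kronecker Matrix

/-! ### Strictness and duals after adjoining morphisms -/

namespace Adjoin

variable {C : Type u} [Category.{v} C] [MonoidalCategory C] [SymmetricCategory C]
  (G : C → C → Type w) (R : ∀ ⦃A B : C⦄, FormalHom G A B → FormalHom G A B → Prop)

theorem incl_map_eqToHom {A B : C} (h : A = B) (h' : (⟨A⟩ : Adjoin G R) = ⟨B⟩) :
    (incl G R).map (eqToHom h) = eqToHom h' := by
  subst h; rfl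

theorem isStrictMonoidal [IsStrictMonoidal C] : IsStrictMonoidal (Adjoin G R) where
  associator_eq A B D := by
    obtain ⟨h, e⟩ := IsStrictMonoidal.associator_eq A.of B.of D.of
    have h' : (⟨(A.of ⊗ B.of) ⊗ D.of⟩ : Adjoin G R) = ⟨A.of ⊗ (B.of ⊗ D.of)⟩ := congrArg _ h
    exact ⟨h', (congrArg (incl G R).map e).trans (incl_map_eqToHom G R h h')⟩
  leftUnitor_eq A := by
    obtain ⟨h, e⟩ := IsStrictMonoidal.leftUnitor_eq A.of
    have h' : (⟨𝟙_ C ⊗ A.of⟩ : Adjoin G R) = ⟨A.of⟩ := congrArg _ h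
    exact ⟨h', (congrArg (incl G R).map e).trans (incl_map_eqToHom G R h h')⟩
  rightUnitor_eq A := by
    obtain ⟨h, e⟩ := IsStrictMonoidal.rightUnitor_eq A.of
    have h' : (⟨A.of ⊗ 𝟙_ C⟩ : Adjoin G R) = ⟨A.of⟩ := congrArg _ h
    exact ⟨h', (congrArg (incl G R).map e).trans (incl_map_eqToHom G R h h')⟩

theorem isStrictMonoidalFunctor_incl : IsStrictMonoidalFunctor (incl G R) where
  unit_eq := ⟨rfl, rfl⟩
  tensor_eq _ _ := ⟨rfl, rfl⟩

theorem bijective_incl_obj : Function.Bijective (incl G R).obj :=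
  ⟨fun _ _ h => congrArg Adjoin.of h, fun A => ⟨A.of, rfl⟩⟩

theorem incl_map_whiskerLeft (A : C) {B B' : C} (f : B ⟶ B') :
    (incl G R).map (A ◁ f) = (⟨A⟩ : Adjoin G R) ◁ (incl G R).map f := by
  rw [← id_tensorHom, ← id_tensorHom, ← incl_tensor]; rfl

theorem incl_map_whiskerRight {B B' : C} (f : B ⟶ B') (A : C) :
    (incl G R).map (f ▷ A) = (incl G R).map f ▷ (⟨A⟩ : Adjoin G R) := by
  rw [← tensorHom_id, ← tensorHom_id, ← incl_tensor]; rfl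

/-- An exact pairing of `C` is an exact pairing of the extended category. -/
abbrev exactPairing (A B : C) [ExactPairing A B] :
    ExactPairing (⟨A⟩ : Adjoin G R) (⟨B⟩ : Adjoin G R) where
  coevaluation' := (incl G R).map (η_ A B)
  evaluation' := (incl G R).map (ε_ A B)
  coevaluation_evaluation' := by
    have h := congrArg (incl G R).map (ExactPairing.coevaluation_evaluation A B)
    simp only [Functor.map_comp, incl_map_whiskerLeft, incl_map_whiskerRight] at h
    exact h
  evaluation_coevaluation' := by
    have h := congrArg (incl G R).map (ExactPairing.evaluation_coevaluation A B)
    simp only [Functor.map_comp, incl_map_whiskerLeft, incl_map_whiskerRight] at h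
    exact h

theorem isCompactClosed (h : ∀ A : C, ∃ A' : C, Nonempty (ExactPairing A' A)) :
    IsCompactClosed (Adjoin G R) where
  exists_dual A := by
    obtain ⟨A', ⟨_⟩⟩ := h A.of
    exact ⟨⟨A'⟩, ⟨exactPairing G R A' A.of⟩⟩

end Adjoin

/-! ### Terminality of the unit in the affine completion -/

namespace Affine

variable {C : Type u} [Category.{v} C] [MonoidalCategory C] [SymmetricCategory C]

theorem comp_discard {A B : C} (f : (⟨A⟩ : Affine C) ⟶ ⟨B⟩) : f ≫ discard C B = discard C A := by
  obtain ⟨s⟩ := f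
  exact Adjoin.homMk_eq (.of (.natural s))

theorem discard_unit : discard C (𝟙_ C) = 𝟙 _ :=
  Adjoin.homMk_eq (.of .unit)

/-- Both sides are maps into the unit, which is terminal: any such map is unchanged by composing
with `discard C (𝟙_ C)`, an identity, and naturality turns that composite into the discard map. -/
theorem discard_tensor (A B : C) :
    (discard C A ⊗ₘ discard C B) ≫ (λ_ (𝟙_ (Affine C))).hom = discard C (A ⊗ B) := by
  rw [← comp_discard ((discard C A ⊗ₘ discard C B) ≫ (λ_ (𝟙_ (Affine C))).hom :
    (⟨A ⊗ B⟩ : Affine C) ⟶ ⟨𝟙_ C⟩), discard_unit]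
  exact (Category.comp_id _).symm

end Affine

/-! ### Discarding and purification in `C^⏚` -/

namespace DiscardCat

variable {C : Type u} [Category.{v} C] [MonoidalCategory C] [SymmetricCategory C] [DaggerSMC C]

theorem ofAffine_comp {A B E : C} (f : IsoAffineHom A B) (g : IsoAffineHom B E) :
    ofAffine (f ≫ g) = ofAffine f ≫ ofAffine g :=
  (Adjoin.homMk_eq (.of (.comp f g))).symm

theorem ofAffine_tensor {A B A' B' : C} (f : IsoAffineHom A B) (g : IsoAffineHom A' B') :
    ofAffine (f ⊗ₘ g : IsoAffineHom (A ⊗ A') (B ⊗ B')) =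
      (ofAffine f ⊗ₘ ofAffine g : (⟨A ⊗ A'⟩ : DiscardCat C) ⟶ ⟨B ⊗ B'⟩) :=
  (Adjoin.homMk_eq (.of (.tensor f g))).symm

theorem ofAffine_incl {A B : C} (u : (⟨A⟩ : IsometryCat C) ⟶ ⟨B⟩) :
    ofAffine ((Adjoin.incl _ _).map u : IsoAffineHom A B) = (incl C).map u.hom :=
  Adjoin.homMk_eq (.of (.glue u))

/-- A morphism of `C`, as a morphism of `C^⏚`. -/
def base {A B : DiscardCat C} (f : A.of ⟶ B.of) : A ⟶ B := (incl C).map f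

/-- The discard map of an object of `C^⏚`. -/
def discard (A : DiscardCat C) : A ⟶ 𝟙_ (DiscardCat C) := disc C A.of

theorem base_comp {A B E : DiscardCat C} (f : A.of ⟶ B.of) (g : B.of ⟶ E.of) :
    base (f ≫ g) = (base f : A ⟶ B) ≫ (base g : B ⟶ E) :=
  (incl C).map_comp f g

theorem base_whiskerLeft (A : DiscardCat C) {B B' : DiscardCat C} (f : B.of ⟶ B'.of) :
    (base (A.of ◁ f) : A ⊗ B ⟶ A ⊗ B') = A ◁ base f :=
  Adjoin.incl_map_whiskerLeft _ _ A.of f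

theorem base_whiskerRight {B B' : DiscardCat C} (f : B.of ⟶ B'.of) (A : DiscardCat C) :
    (base (f ▷ A.of) : B ⊗ A ⟶ B' ⊗ A) = base f ▷ A :=
  Adjoin.incl_map_whiskerRight _ _ f A.of

/-- The gluing relation lets an isometry be read in `C_iso^!`, where the discard maps are natural.
-/
theorem base_comp_discard {A B : DiscardCat C} (f : A.of ⟶ B.of) (hf : isometries C f) :
    base f ≫ discard B = discard A := by
  let u : (⟨A.of⟩ : IsometryCat C) ⟶ ⟨B.of⟩ := ⟨f, hf⟩
  refine (congrArg (· ≫ disc C B.of) (ofAffine_incl u).symm).trans ?_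
  exact (ofAffine_comp _ _).symm.trans (congrArg ofAffine (Affine.comp_discard _))

theorem discard_unit : discard (𝟙_ (DiscardCat C)) = 𝟙 (𝟙_ (DiscardCat C)) :=
  (congrArg ofAffine Affine.discard_unit).trans (ofAffine_incl (𝟙 (𝟙_ (IsometryCat C))))

theorem discard_tensor (A B : DiscardCat C) :
    discard (A ⊗ B) = (discard A ⊗ₘ discard B) ≫ (λ_ (𝟙_ (DiscardCat C))).hom := by
  have h := congrArg ofAffine (Affine.discard_tensor (C := IsometryCat C) ⟨A.of⟩ ⟨B.of⟩)
  refine h.symm.trans ((ofAffine_comp _ _).trans ?_)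
  exact congrArg₂ (· ≫ ·) (ofAffine_tensor _ _) (ofAffine_incl (λ_ (𝟙_ (IsometryCat C))).hom)

/-- The morphism `(1_B ⊗ ⏚_X) ∘ ι f`. -/
def purified {A B X : DiscardCat C} (f : A.of ⟶ (B ⊗ X).of) : A ⟶ B :=
  base f ≫ B ◁ discard X ≫ (ρ_ B).hom

/-- The comparison `δ` of the inclusion is an identity. `purified` drops it and stays among objects
of `C^⏚`, so that the coherence lemmas of that category apply. -/
theorem discardOutput_eq {A B X : C} (f : A ⟶ B ⊗ X) :
    discardOutput (incl C) (disc C) f =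
      purified (A := ⟨A⟩) (B := ⟨B⟩) (X := ⟨X⟩) f :=
  congrArg ((incl C).map f ≫ ·) (Category.id_comp _)

/-- The morphisms of the form `(1_B ⊗ ⏚_X) ∘ ι f`. -/
def IsPurified {A B : DiscardCat C} (h : A ⟶ B) : Prop :=
  ∃ (X : DiscardCat C) (f : A.of ⟶ (B ⊗ X).of), h = purified f

namespace IsPurified

theorem base_comp {A B E : DiscardCat C} (f : A.of ⟶ B.of) {h : B ⟶ E}
    (hh : IsPurified h) : IsPurified (base f ≫ h) := by
  obtain ⟨X, k, rfl⟩ := hh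
  exact ⟨X, f ≫ k, by simp only [purified, DiscardCat.base_comp f k, Category.assoc]⟩

/-- By interchange, a morphism on the kept wire slides before the discard of the other wire. -/
theorem comp_base {A B E : DiscardCat C} {h : A ⟶ B}
    (hh : IsPurified h) (f : B.of ⟶ E.of) : IsPurified (h ≫ base f) := by
  obtain ⟨X, k, rfl⟩ := hh
  refine ⟨X, k ≫ f ▷ X.of, ?_⟩
  rw [purified, purified, DiscardCat.base_comp (E := E ⊗ X) k, base_whiskerRight]
  simp only [Category.assoc]
  rw [← whisker_exchange_assoc]
  simp

theorem base {A B : DiscardCat C} (f : A.of ⟶ B.of) : IsPurified (base f : A ⟶ B) := by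
  -- The discarded wire is the unit, whose discard map is the identity.
  refine ⟨𝟙_ _, f ≫ (ρ_ B.of).inv, ?_⟩
  rw [purified, DiscardCat.base_comp (B := B) (E := B ⊗ 𝟙_ _), discard_unit]
  change _ = (_ ≫ (ρ_ B).inv) ≫ _
  simp

theorem discard (A : DiscardCat C) : IsPurified (discard A) := by
  refine ⟨A, (λ_ A.of).inv, ?_⟩
  change _ = (λ_ A).inv ≫ _
  simp [← unitors_equal]

theorem whiskerLeft (E : DiscardCat C) {A B : DiscardCat C} {h : A ⟶ B} (hh : IsPurified h) :
    IsPurified (E ◁ h) := by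
  obtain ⟨X, k, rfl⟩ := hh
  refine ⟨X, E.of ◁ k ≫ (α_ E.of B.of X.of).inv, ?_⟩
  rw [purified, purified,
    DiscardCat.base_comp (A := E ⊗ A) (B := E ⊗ (B ⊗ X)) (E := (E ⊗ B) ⊗ X)]
  rw [base_whiskerLeft]
  change _ = (_ ≫ (α_ E B X).inv) ≫ _
  simp

/-- Discarding `X` and then `Y` is the same as discarding `Y ⊗ X`, by multiplicativity of the
discard maps. -/
theorem comp_discard {A B Y : DiscardCat C} {h : A ⟶ B ⊗ Y} (hh : IsPurified h) :
    IsPurified (h ≫ B ◁ DiscardCat.discard Y ≫ (ρ_ B).hom) := by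
  obtain ⟨X, k, rfl⟩ := hh
  refine ⟨Y ⊗ X, k ≫ (α_ B.of Y.of X.of).hom, ?_⟩
  rw [purified, purified, DiscardCat.base_comp (B := (B ⊗ Y) ⊗ X) (E := B ⊗ Y ⊗ X), discard_tensor]
  change _ = (_ ≫ (α_ B Y X).hom) ≫ _
  simp only [MonoidalCategory.tensorHom_def', MonoidalCategory.whiskerLeft_comp, Category.assoc]
  congr 1
  simp [unitors_equal]

theorem comp {A B E : DiscardCat C} {h : A ⟶ B} {k : B ⟶ E} (hh : IsPurified h)
    (hk : IsPurified k) : IsPurified (h ≫ k) := by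
  obtain ⟨Y, g, rfl⟩ := hk
  rw [purified, ← Category.assoc]
  exact (hh.comp_base (E := E ⊗ Y) g).comp_discard

theorem whiskerRight {A B : DiscardCat C} {h : A ⟶ B} (hh : IsPurified h) (E : DiscardCat C) :
    IsPurified (h ▷ E) := by
  have e : h ▷ E = (β_ A E).hom ≫ E ◁ h ≫ (β_ E B).hom := by
    simp
  rw [e]
  exact ((hh.whiskerLeft E).comp_base (E := B ⊗ E) (β_ E.of B.of).hom).base_comp (A := A ⊗ E)
    (β_ A.of E.of).hom

theorem tensor {A B A' B' : DiscardCat C} {h : A ⟶ B} {k : A' ⟶ B'} (hh : IsPurified h)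
    (hk : IsPurified k) : IsPurified (h ⊗ₘ k) := by
  rw [MonoidalCategory.tensorHom_def]
  exact (hh.whiskerRight A').comp (hk.whiskerLeft B)

/-- Structural induction: the closure properties above match the constructors of formal morphisms.
The same induction is then run one level up, where a generator of `C^⏚` is itself a class of such
formal morphisms. -/
theorem ofAffine : ∀ {A B : IsometryCat C} (s : FormalHom AffineGen A B),
    IsPurified (DiscardCat.ofAffine (Adjoin.homMk s : IsoAffineHom A.obj B.obj))
  | A, B, .base u => by
    have h := base (A := ⟨A.obj⟩) (B := ⟨B.obj⟩) u.hom
    exact (congrArg IsPurified (ofAffine_incl u)).mpr h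
  | _, _, .gen (.discard A) => discard ⟨A.obj⟩
  | _, _, .comp s t =>
    (congrArg IsPurified (ofAffine_comp _ _)).mpr ((ofAffine s).comp (ofAffine t))
  | _, _, .tensor s t =>
    (congrArg IsPurified (ofAffine_tensor _ _)).mpr ((ofAffine s).tensor (ofAffine t))

theorem homMk : ∀ {A B : C} (s : FormalHom IsoAffineHom A B),
    IsPurified (Adjoin.homMk s : (incl C).obj A ⟶ (incl C).obj B)
  | A, B, .base f => base (A := ⟨A⟩) (B := ⟨B⟩) f
  | _, _, .gen g => by
    obtain ⟨s⟩ := g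
    exact ofAffine s
  | _, _, .comp s t => (homMk s).comp (homMk t)
  | _, _, .tensor s t => (homMk s).tensor (homMk t)

end IsPurified

theorem exists_eq_discardOutput {A B : C} (f : (incl C).obj A ⟶ (incl C).obj B) :
    ∃ (X : C) (f' : A ⟶ B ⊗ X), f = discardOutput (incl C) (disc C) f' := by
  obtain ⟨s⟩ := f
  obtain ⟨X, f', h⟩ := IsPurified.homMk s
  exact ⟨X.of, f', h.trans (discardOutput_eq f').symm⟩

/-- An isometry acting only on the discarded wire is absorbed by the discard map. -/
theorem purified_comp_whiskerLeft {A B X Z : DiscardCat C} (f : A.of ⟶ (B ⊗ X).of)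
    (r : X.of ⟶ Z.of) (hr : isometries C r) :
    purified (B := B) (X := Z) (f ≫ B.of ◁ r) = purified f := by
  rw [purified, purified, ← base_comp_discard r hr, base_comp (B := B ⊗ X) (E := B ⊗ Z),
    base_whiskerLeft, MonoidalCategory.whiskerLeft_comp]
  simp only [Category.assoc]

theorem discardOutput_eq_of_isometries {A B X Y Z : C} {f : A ⟶ B ⊗ X} {g : A ⟶ B ⊗ Y}
    {r : X ⟶ Z} {s : Y ⟶ Z} (hr : isometries C r) (hs : isometries C s)
    (h : f ≫ B ◁ r = g ≫ B ◁ s) :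
    discardOutput (incl C) (disc C) f = discardOutput (incl C) (disc C) g := by
  have h1 := purified_comp_whiskerLeft (A := ⟨A⟩) (B := ⟨B⟩) (X := ⟨X⟩) (Z := ⟨Z⟩) f r hr
  have h2 := purified_comp_whiskerLeft (A := ⟨A⟩) (B := ⟨B⟩) (X := ⟨Y⟩) (Z := ⟨Z⟩) g s hs
  have h3 : f ≫ (⟨B⟩ : DiscardCat C).of ◁ r = g ≫ (⟨B⟩ : DiscardCat C).of ◁ s := h
  rw [discardOutput_eq, discardOutput_eq, ← h1, ← h2, h3]

end DiscardCat

/-- `C^⏚` is an environment structure as soon as `∼cp` characterizes equality of purified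
morphisms. -/
theorem isEnvironmentStructure_discardCat {C : Type u} [Category.{v} C] [MonoidalCategory C]
    [SymmetricCategory C] [IsStrictMonoidal C] [DaggerSMC C] [IsDaggerCompact C]
    (h : ∀ {A B X Y : C} (f : A ⟶ B ⊗ X) (g : A ⟶ B ⊗ Y), CPRel f g ↔
      discardOutput (DiscardCat.incl C) (DiscardCat.disc C) f =
        discardOutput (DiscardCat.incl C) (DiscardCat.disc C) g) :
    IsEnvironmentStructure (DiscardCat.incl C) (DiscardCat.disc C) where
  strict := Adjoin.isStrictMonoidal _ _
  compactClosed := Adjoin.isCompactClosed _ _ fun A =>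
    let ⟨A', p, _⟩ := IsDaggerCompact.exists_dual A
    ⟨A', ⟨p⟩⟩
  bijective_obj := Adjoin.bijective_incl_obj _ _
  strict_functor := Adjoin.isStrictMonoidalFunctor_incl _ _
  disc_unit := DiscardCat.discard_unit
  disc_tensor A B := (DiscardCat.discard_tensor ⟨A⟩ ⟨B⟩).trans (Category.id_comp _).symm
  exists_purification := DiscardCat.exists_eq_discardOutput
  cp_iff := h

/-! ### Matrix models, doubling and the trace -/

/-- The matrix of a bijection. -/
def bijMatrix {X Y : Type*} [DecidableEq Y] (σ : X ≃ Y) : Matrix Y X ℂ :=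
  (1 : Matrix Y Y ℂ).submatrix id σ

theorem bijMatrix_apply {X Y : Type*} [DecidableEq Y] (σ : X ≃ Y) (y : Y) (x : X) :
    bijMatrix σ y x = if y = σ x then 1 else 0 := by
  simp [bijMatrix, Matrix.one_apply]

theorem mul_bijMatrix {X Y Z : Type*} [DecidableEq Y] [Fintype Y] (σ : X ≃ Y)
    (N : Matrix Z Y ℂ) : N * bijMatrix σ = N.submatrix id σ := by
  ext z x
  simp [Matrix.mul_apply, bijMatrix_apply]

theorem bijMatrix_mul {X Y Z : Type*} [DecidableEq Y] [Fintype X] (σ : X ≃ Y)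
    (N : Matrix X Z ℂ) : bijMatrix σ * N = N.submatrix σ.symm id := by
  classical
  ext y z
  simp [Matrix.mul_apply, bijMatrix_apply, ← Equiv.symm_apply_eq]

/-- The entries are 0 or 1, so conjugation does nothing. This is why structural morphisms remain
bijections in the doubled model. -/
theorem bijMatrix_kronecker_map_star {X Y : Type*} [DecidableEq Y] (σ : X ≃ Y) :
    bijMatrix σ ⊗ₖ (bijMatrix σ).map star = bijMatrix (σ.prodCongr σ) := by
  ext ⟨y, y'⟩ ⟨x, x'⟩
  simp only [Matrix.kronecker_apply, Matrix.map_apply, bijMatrix_apply, Equiv.prodCongr_apply,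
    Prod.map_apply, Prod.mk.injEq]
  split_ifs <;> simp_all

theorem one_kronecker_bijMatrix {W X Y P Q : Type*} [DecidableEq W] [DecidableEq Y]
    [DecidableEq P] (σ : X ≃ Y) (p : P ≃ W × Y) (q : Q ≃ W × X) :
    ((1 : Matrix W W ℂ) ⊗ₖ bijMatrix σ).submatrix p q =
      bijMatrix ((q.trans ((Equiv.refl W).prodCongr σ)).trans p.symm) := by
  ext y x
  simp only [Matrix.submatrix_apply, Matrix.kroneckerMap_apply, bijMatrix_apply, Matrix.one_apply,
    Equiv.trans_apply, Equiv.eq_symm_apply, Equiv.prodCongr_apply, Prod.ext_iff, Prod.map_fst,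
    Prod.map_snd, Equiv.refl_apply, ite_and, ite_mul, one_mul, zero_mul]

/-- A functor from a symmetric monoidal category to complex matrices, tensor products
corresponding to Kronecker products and structural morphisms to the evident bijections. -/
structure MatrixModel (C : Type u) [Category.{v} C] [MonoidalCategory C] [SymmetricCategory C] where
  /-- The index set of an object. -/
  idx : C → Type
  fintype : ∀ A, Fintype (idx A)
  decEq : ∀ A, DecidableEq (idx A)
  /-- Indices of a tensor product are pairs of indices. -/
  prod : ∀ A B, idx (A ⊗ B) ≃ idx A × idx B
  unique : Unique (idx (𝟙_ C))
  /-- The matrix of a morphism. -/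
  mat : ∀ {A B : C}, (A ⟶ B) → Matrix (idx B) (idx A) ℂ
  mat_id : ∀ A : C, mat (𝟙 A) = 1
  mat_comp : ∀ {A B E : C} (f : A ⟶ B) (g : B ⟶ E), mat (f ≫ g) = mat g * mat f
  mat_tensor : ∀ {A B A' B' : C} (f : A ⟶ B) (g : A' ⟶ B'),
    mat (f ⊗ₘ g) = (mat f ⊗ₖ mat g).submatrix (prod B B') (prod A A')
  mat_associator : ∀ A B E : C, mat (α_ A B E).hom = bijMatrix
    ((prod (A ⊗ B) E).trans <| ((prod A B).prodCongr (.refl _)).trans <|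
      (Equiv.prodAssoc _ _ _).trans <| ((Equiv.refl _).prodCongr (prod B E).symm).trans
        (prod A (B ⊗ E)).symm)
  mat_leftUnitor : ∀ A : C, mat (λ_ A).hom = bijMatrix ((prod (𝟙_ C) A).trans (Equiv.uniqueProd _ _))
  mat_rightUnitor : ∀ A : C, mat (ρ_ A).hom = bijMatrix ((prod A (𝟙_ C)).trans (Equiv.prodUnique _ _))
  mat_braiding : ∀ A B : C, mat (β_ A B).hom = bijMatrix
    ((prod A B).trans <| (Equiv.prodComm _ _).trans (prod B A).symm)

attribute [instance] MatrixModel.fintype MatrixModel.decEq MatrixModel.unique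

namespace MatrixModel

variable {C : Type u} [Category.{v} C] [MonoidalCategory C] [SymmetricCategory C]

/-- The model of completely positive maps, sending `f` to `f ⊗ f̄`. -/
def double (M : MatrixModel C) : MatrixModel C where
  idx A := M.idx A × M.idx A
  fintype _ := inferInstance
  decEq _ := inferInstance
  -- Regroups `((a, b), (a', b'))` as `((a, a'), (b, b'))`.
  prod A B := ((M.prod A B).prodCongr (M.prod A B)).trans (Equiv.prodProdProdComm _ _ _ _)
  unique := ⟨⟨(default, default)⟩, fun _ => Subsingleton.elim _ _⟩
  mat f := M.mat f ⊗ₖ (M.mat f).map star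
  mat_id A := by
    rw [M.mat_id, Matrix.map_one star (star_zero _) (star_one _), Matrix.one_kronecker_one]
  mat_comp f g := by
    have h : (M.mat g * M.mat f).map star = (M.mat g).map star * (M.mat f).map star :=
      Matrix.map_mul (f := starRingEnd ℂ)
    rw [M.mat_comp, h, Matrix.mul_kronecker_mul]
  mat_tensor f g := by
    rw [M.mat_tensor]
    ext ⟨y, y'⟩ ⟨x, x'⟩
    simp only [Matrix.kroneckerMap_apply, Matrix.map_apply, Matrix.submatrix_apply, star_mul',
      Equiv.trans_apply, Equiv.prodCongr_apply, Prod.map_apply, Equiv.prodProdProdComm_apply]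
    ring
  mat_associator A B E := by
    rw [M.mat_associator, bijMatrix_kronecker_map_star]; rfl
  mat_leftUnitor A := by
    rw [M.mat_leftUnitor, bijMatrix_kronecker_map_star]; rfl
  mat_rightUnitor A := by
    rw [M.mat_rightUnitor, bijMatrix_kronecker_map_star]; rfl
  mat_braiding A B := by
    rw [M.mat_braiding, bijMatrix_kronecker_map_star]; rfl

/-- The restriction of a model to the isometries. -/
def isometry [DaggerSMC C] (M : MatrixModel C) : MatrixModel (IsometryCat C) where
  idx A := M.idx A.obj
  fintype _ := inferInstance
  decEq _ := inferInstance
  prod A B := M.prod A.obj B.obj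
  unique := M.unique
  mat f := M.mat f.hom
  mat_id A := M.mat_id A.obj
  mat_comp f g := M.mat_comp f.hom g.hom
  mat_tensor f g := M.mat_tensor f.hom g.hom
  mat_associator A B E := M.mat_associator A.obj B.obj E.obj
  mat_leftUnitor A := M.mat_leftUnitor A.obj
  mat_rightUnitor A := M.mat_rightUnitor A.obj
  mat_braiding A B := M.mat_braiding A.obj B.obj

section Eval

variable (M : MatrixModel C) {G : C → C → Type w}
  (γ : ∀ {A B : C}, G A B → Matrix (M.idx B) (M.idx A) ℂ)

/-- The matrix of a formal morphism, given the matrices of the generators. -/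
def eval : ∀ {A B : C}, FormalHom G A B → Matrix (M.idx B) (M.idx A) ℂ
  | _, _, .base f => M.mat f
  | _, _, .gen g => γ g
  | _, _, .comp s t => eval t * eval s
  | _, _, .tensor s t => (eval s ⊗ₖ eval t).submatrix (M.prod _ _) (M.prod _ _)

/-- Soundness of evaluation: matrices already satisfy the axioms of symmetric monoidal categories,
so only the extra relations `R` need checking. -/
theorem eval_eq_of_formalRel {R : ∀ ⦃A B : C⦄, FormalHom G A B → FormalHom G A B → Prop}
    (hR : ∀ {A B : C} {s t : FormalHom G A B}, R s t → M.eval γ s = M.eval γ t)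
    {A B : C} {s t : FormalHom G A B} (h : FormalRel G R s t) : M.eval γ s = M.eval γ t := by
  induction h with
  | of h => exact hR h
  | refl => rfl
  | symm _ ih => exact ih.symm
  | trans _ _ ih ih' => exact ih.trans ih'
  | comp_congr _ _ ih ih' => simp only [eval, ih, ih']
  | tensor_congr _ _ ih ih' => simp only [eval, ih, ih']
  | base_comp f g => exact (M.mat_comp f g).symm
  | base_tensor f g => exact (M.mat_tensor f g).symm
  | id_comp s => simp only [eval, M.mat_id, Matrix.mul_one]
  | comp_id s => simp only [eval, M.mat_id, Matrix.one_mul]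
  | assoc s t r => simp only [eval, Matrix.mul_assoc]
  | tensor_comp s s' t t' =>
    simp only [eval, Matrix.submatrix_mul_equiv, Matrix.mul_kronecker_mul]
  | associator_naturality s s' s'' =>
    simp only [eval, M.mat_associator, bijMatrix_mul, mul_bijMatrix]
    ext y x
    simp [mul_assoc]
  | leftUnitor_naturality s =>
    simp only [eval, M.mat_leftUnitor, M.mat_id, bijMatrix_mul, mul_bijMatrix]
    ext y x
    simp [Matrix.one_apply, eq_iff_true_of_subsingleton]
  | rightUnitor_naturality s =>
    simp only [eval, M.mat_rightUnitor, M.mat_id, bijMatrix_mul, mul_bijMatrix]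
    ext y x
    simp [Matrix.one_apply, eq_iff_true_of_subsingleton]
  | braiding_naturality s s' =>
    simp only [eval, M.mat_braiding, bijMatrix_mul, mul_bijMatrix]
    ext y x
    simp [mul_comm]

end Eval

variable (M : MatrixModel C)

/-- The trace, as a matrix. -/
def traceMatrix (A : C) : Matrix (M.double.idx (𝟙_ C)) (M.double.idx A) ℂ :=
  fun _ x => if x.1 = x.2 then 1 else 0

/-- The doubled matrices of the discard maps. -/
def evalAffineGen : ∀ {A B : C}, AffineGen A B → Matrix (M.double.idx B) (M.double.idx A) ℂ
  | _, _, .discard A => M.traceMatrix A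

theorem traceMatrix_unit : M.traceMatrix (𝟙_ C) = 1 := by
  ext y x
  simp [traceMatrix, Matrix.one_apply, Subsingleton.elim x.1 x.2, Subsingleton.elim y x]

theorem traceMatrix_tensor (A B : C) (y : M.double.idx (𝟙_ C)) (x : M.double.idx (A ⊗ B)) :
    M.traceMatrix (A ⊗ B) y x =
      M.traceMatrix A y (M.double.prod A B x).1 * M.traceMatrix B y (M.double.prod A B x).2 := by
  obtain ⟨x, x'⟩ := x
  change (if x = x' then (1 : ℂ) else 0) =
    (if (M.prod A B x).1 = (M.prod A B x').1 then 1 else 0) *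
      (if (M.prod A B x).2 = (M.prod A B x').2 then 1 else 0)
  have h := (M.prod A B).apply_eq_iff_eq (x := x) (y := x')
  rw [Prod.ext_iff] at h
  simp only [← h, ite_and, mul_ite, mul_one, mul_zero]
  split_ifs <;> rfl

theorem traceMatrix_mul_apply {A B : C} (N : Matrix (M.double.idx B) (M.double.idx A) ℂ)
    (y : M.double.idx (𝟙_ C)) (x : M.double.idx A) :
    (M.traceMatrix B * N) y x = ∑ i : M.idx B, N (i, i) x := by
  change ∑ z : M.idx B × M.idx B, (if z.1 = z.2 then 1 else 0) * N z x = _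
  simp [Fintype.sum_prod_type]

/-- Trace preservation. It is needed for all formal morphisms because the naturality relation of
`AffineRel` quantifies over all of them. For a base morphism it is the equation `f† f = 1`, and it
is inherited by composites and tensor products. -/
theorem traceMatrix_mul_eval (hM : ∀ {A B : C} (f : A ⟶ B), (M.mat f)ᴴ * M.mat f = 1) :
    ∀ {A B : C} (s : FormalHom AffineGen A B),
      M.traceMatrix B * M.double.eval M.evalAffineGen s = M.traceMatrix A
  | A, B, .base f => by
    ext y ⟨x, x'⟩
    -- The second copy is the conjugated one, so `x'` is the row index of `f† f`.
    have h := congrFun (congrFun (hM f) x') x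
    simp only [Matrix.mul_apply, Matrix.conjTranspose_apply, Matrix.one_apply] at h
    refine (M.traceMatrix_mul_apply _ y _).trans ?_
    refine (Finset.sum_congr rfl fun i _ => mul_comm (M.mat f i x) (star (M.mat f i x'))).trans ?_
    exact h.trans (by simp only [eq_comm]; rfl)
  | _, _, .gen (.discard A) => by
    rw [traceMatrix_unit]
    exact Matrix.one_mul _
  | _, _, .comp s t => by
    rw [eval, ← Matrix.mul_assoc, traceMatrix_mul_eval hM t, traceMatrix_mul_eval hM s]
  | _, _, .tensor (A := A) (B := B) (A' := A') (B' := B') s t => by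
    ext y x
    have h1 := congrFun (congrFun (traceMatrix_mul_eval hM s) y) (M.double.prod A A' x).1
    have h2 := congrFun (congrFun (traceMatrix_mul_eval hM t) y) (M.double.prod A A' x).2
    rw [traceMatrix_tensor, ← h1, ← h2]
    simp only [Matrix.mul_apply, traceMatrix_tensor, eval, Finset.sum_mul_sum,
      Matrix.submatrix_apply, Matrix.kroneckerMap_apply]
    rw [← (M.double.prod B B').symm.sum_comp, Fintype.sum_prod_type]
    simp only [Equiv.apply_symm_apply]
    exact Finset.sum_congr rfl fun i _ => Finset.sum_congr rfl fun j _ => by ring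

theorem eval_eq_of_affineRel (hM : ∀ {A B : C} (f : A ⟶ B), (M.mat f)ᴴ * M.mat f = 1)
    {A B : C} {s t : FormalHom AffineGen A B} (h : FormalRel AffineGen (AffineRel C) s t) :
    M.double.eval M.evalAffineGen s = M.double.eval M.evalAffineGen t := by
  refine M.double.eval_eq_of_formalRel _ (fun h => ?_) h
  cases h with
  | natural f => exact M.traceMatrix_mul_eval hM f
  | unit => exact M.traceMatrix_unit.trans (M.double.mat_id _).symm

end MatrixModel

/-! ### Interpretation of `C^⏚` by completely positive maps -/

/-- A matrix model in which the dagger is the conjugate transpose. -/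
structure DaggerMatrixModel (C : Type u) [Category.{v} C] [MonoidalCategory C]
    [SymmetricCategory C] [DaggerSMC C] extends MatrixModel C where
  mat_dagger : ∀ {A B : C} (f : A ⟶ B), mat (dagger f) = (mat f)ᴴ

namespace DaggerMatrixModel

variable {C : Type u} [Category.{v} C] [MonoidalCategory C] [SymmetricCategory C] [DaggerSMC C]
  (M : DaggerMatrixModel C)

theorem conjTranspose_mul_mat_isometry {A B : IsometryCat C} (f : A ⟶ B) :
    (M.isometry.mat f)ᴴ * M.isometry.mat f = 1 := by
  change (M.mat f.hom)ᴴ * M.mat f.hom = 1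
  rw [← M.mat_dagger, ← M.mat_comp, ← M.mat_id]
  exact congrArg M.mat f.property

/-- The completely positive map, as a matrix, of a morphism of the affine completion of the
isometries. -/
def evalAffine {A B : C} (g : IsoAffineHom A B) : Matrix (M.double.idx B) (M.double.idx A) ℂ :=
  Quotient.lift (M.isometry.double.eval M.isometry.evalAffineGen)
    (fun _ _ h => M.isometry.eval_eq_of_affineRel M.conjTranspose_mul_mat_isometry h) g

/-- All three relations hold definitionally on representatives: `evalAffine` is computed by the same
recursion, and the doubled model of the isometries is the restriction of `M.double`. -/
theorem eval_eq_of_discardRel {A B : C} {s t : FormalHom IsoAffineHom A B}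
    (h : FormalRel IsoAffineHom (DiscardRel C) s t) :
    M.double.eval M.evalAffine s = M.double.eval M.evalAffine t := by
  refine M.double.eval_eq_of_formalRel _ (fun h => ?_) h
  cases h with
  | comp f g =>
    obtain ⟨s⟩ := f
    obtain ⟨t⟩ := g
    rfl
  | tensor f g =>
    obtain ⟨s⟩ := f
    obtain ⟨t⟩ := g
    rfl
  | glue u => rfl

/-- The completely positive map, as a matrix, of a morphism of `C^⏚`. -/
def evalDiscard {A B : C} (h : (DiscardCat.incl C).obj A ⟶ (DiscardCat.incl C).obj B) :
    Matrix (M.double.idx B) (M.double.idx A) ℂ :=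
  Quotient.lift (M.double.eval M.evalAffine) (fun _ _ h => M.eval_eq_of_discardRel h) h

/-- Discarding `X` becomes the partial trace over `X`, which leaves a Kraus sum with operators `(1 ⊗
⟨i|) f`. -/
theorem evalDiscard_discardOutput {A B X : C} (f : A ⟶ B ⊗ X) (y y' : M.idx B) (x x' : M.idx A) :
    M.evalDiscard (discardOutput (DiscardCat.incl C) (DiscardCat.disc C) f) (y, y') (x, x') =
      ∑ i, M.mat f ((M.prod B X).symm (y, i)) x *
        star (M.mat f ((M.prod B X).symm (y', i)) x') := by
  have e : M.evalDiscard (discardOutput (DiscardCat.incl C) (DiscardCat.disc C) f) =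
      M.double.mat (ρ_ B).hom * ((M.double.mat (𝟙 B) ⊗ₖ M.traceMatrix X).submatrix
        (M.double.prod B (𝟙_ C)) (M.double.prod B X)) * M.double.mat f := by
    rw [DiscardCat.discardOutput_eq]
    rfl
  have key (Y : M.double.idx B) (K : M.double.idx A) :
      (M.double.mat (ρ_ B).hom * ((M.double.mat (𝟙 B) ⊗ₖ M.traceMatrix X).submatrix
        (M.double.prod B (𝟙_ C)) (M.double.prod B X)) * M.double.mat f) Y K =
      ∑ i, M.double.mat f ((M.double.prod B X).symm (Y, (i, i))) K := by
    -- The sum over the doubled index of `B ⊗ X` splits; the identity on `B` fixes the first part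
    -- and the trace restricts the second to the diagonal.
    rw [M.double.mat_rightUnitor, bijMatrix_mul, M.double.mat_id, Matrix.mul_apply,
      ← (M.double.prod B X).symm.sum_comp, Fintype.sum_prod_type, Finset.sum_comm]
    simp only [Matrix.submatrix_apply, Matrix.kroneckerMap_apply, Equiv.apply_symm_apply,
      Equiv.symm_trans_apply, Equiv.prodUnique_symm_apply, Matrix.one_apply, ite_mul, one_mul,
      zero_mul, Finset.sum_ite_eq, Finset.mem_univ, if_true, id]
    exact M.traceMatrix_mul_apply
      (fun t k => M.double.mat f ((M.double.prod B X).symm (Y, t)) k) default K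
  rw [e]
  exact key (y, y') (x, x')

/-- Following the wires: `f` takes `x` to `(y, i)`, the symmetry brings `i` next to the input `y'`,
and `f†` takes `(y', i)` to `x'`. Only `i` is summed over, so this is the Kraus sum above with its
indices bent. -/
theorem mat_cpDiagram {A B X : C} (f : A ⟶ B ⊗ X) (y y' : M.idx B) (x x' : M.idx A) :
    M.mat (cpDiagram f) ((M.prod B A).symm (y, x')) ((M.prod A B).symm (x, y')) =
      ∑ i, M.mat f ((M.prod B X).symm (y, i)) x *
        star (M.mat f ((M.prod B X).symm (y', i)) x') := by
  simp only [cpDiagram, M.mat_comp, M.mat_associator, ← id_tensorHom, ← tensorHom_id, M.mat_tensor,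
    M.mat_id, M.mat_dagger, M.mat_braiding, Matrix.mul_assoc, one_kronecker_bijMatrix]
  -- The associator and the symmetry only reindex, leaving one product of `1 ⊗ f†` with `f ⊗ 1`,
  -- whose identity factors then collapse the sums over `B`.
  rw [bijMatrix_mul, bijMatrix_mul]
  rw [Matrix.mul_apply, ← (M.prod B (B ⊗ X)).symm.sum_comp, Fintype.sum_prod_type]
  simp only [← (M.prod B X).symm.sum_comp, Fintype.sum_prod_type]
  simp [Matrix.one_apply, mul_comm]

theorem cpRel_iff (hM : ∀ {A B : C} (f g : A ⟶ B), M.mat f = M.mat g → f = g) {A B X Y : C}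
    (f : A ⟶ B ⊗ X) (g : A ⟶ B ⊗ Y) :
    CPRel f g ↔ ∀ (y y' : M.idx B) (x x' : M.idx A),
      ∑ i, M.mat f ((M.prod B X).symm (y, i)) x * star (M.mat f ((M.prod B X).symm (y', i)) x') =
      ∑ i, M.mat g ((M.prod B Y).symm (y, i)) x * star (M.mat g ((M.prod B Y).symm (y', i)) x') := by
  constructor
  · intro h y y' x x'
    rw [← M.mat_cpDiagram f, ← M.mat_cpDiagram g, h]
  · intro h
    refine hM _ _ (Matrix.ext fun z w => ?_)
    obtain ⟨⟨y, x'⟩, rfl⟩ := (M.prod B A).symm.surjective z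
    obtain ⟨⟨x, y'⟩, rfl⟩ := (M.prod A B).symm.surjective w
    rw [M.mat_cpDiagram f, M.mat_cpDiagram g, h]

end DaggerMatrixModel

/-! ### Entries of linear maps between Hilbert spaces -/

namespace FHilb

/-- The matrix of a linear map. -/
noncomputable def entries {a b : ℕ} (f : HilbSpace a →ₗ[ℂ] HilbSpace b) : Matrix (Fin b) (Fin a) ℂ :=
  fun y x => f (EuclideanSpace.single x 1) y

theorem apply_eq_sum_entries {a b : ℕ} (f : HilbSpace a →ₗ[ℂ] HilbSpace b) (v : HilbSpace a)
    (y : Fin b) : f v y = ∑ x, entries f y x * v x := by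
  conv_lhs => rw [sum_single v]
  simp [entries, mul_comm]

theorem entries_injective {a b : ℕ} :
    Function.Injective (entries : (HilbSpace a →ₗ[ℂ] HilbSpace b) → _) := fun f g h => by
  ext v y
  rw [apply_eq_sum_entries, apply_eq_sum_entries, h]

theorem entries_id (a : ℕ) : entries (LinearMap.id : HilbSpace a →ₗ[ℂ] HilbSpace a) = 1 := by
  ext y x
  simp [entries, Matrix.one_apply]

theorem entries_comp {a b c : ℕ} (f : HilbSpace a →ₗ[ℂ] HilbSpace b)
    (g : HilbSpace b →ₗ[ℂ] HilbSpace c) : entries (g ∘ₗ f) = entries g * entries f := by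
  ext y x
  exact apply_eq_sum_entries g _ y

theorem single_eq_tensor {a b : ℕ} (k : Fin (a * b)) :
    (EuclideanSpace.single k 1 : HilbSpace (a * b)) = tensorEquiv a b
      (EuclideanSpace.single (finProdFinEquiv.symm k).1 1 ⊗ₜ
        EuclideanSpace.single (finProdFinEquiv.symm k).2 1) := by
  ext l
  rw [tensorEquiv_apply]
  have h : l = k ↔ l.divNat = k.divNat ∧ l.modNat = k.modNat := by
    rw [← finProdFinEquiv.symm.apply_eq_iff_eq, Prod.ext_iff]; rfl
  simp only [PiLp.single_apply, finProdFinEquiv_symm_apply, h, ite_and]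
  split_ifs <;> simp

theorem tensor_single {a b : ℕ} (i : Fin a) (j : Fin b) :
    tensorEquiv a b (EuclideanSpace.single i 1 ⊗ₜ EuclideanSpace.single j 1) =
      EuclideanSpace.single (finProdFinEquiv (i, j)) 1 := by
  rw [single_eq_tensor, Equiv.symm_apply_apply]

theorem entries_tensorLin {a b a' b' : ℕ} (f : HilbSpace a →ₗ[ℂ] HilbSpace b)
    (g : HilbSpace a' →ₗ[ℂ] HilbSpace b') : entries (tensorLin f g) =
      (entries f ⊗ₖ entries g).submatrix finProdFinEquiv.symm finProdFinEquiv.symm := by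
  ext y x
  rw [entries, single_eq_tensor, tensorLin_apply, tensorEquiv_apply]
  rfl

/-- Reduces the matrix of each structural isomorphism to its effect on basis vectors, which
`single_eq_tensor` writes as pure tensors. -/
theorem entries_eq_bijMatrix {a b : ℕ} {f : HilbSpace a →ₗ[ℂ] HilbSpace b} (σ : Fin a ≃ Fin b)
    (h : ∀ x, f (EuclideanSpace.single x 1) = EuclideanSpace.single (σ x) 1) :
    entries f = bijMatrix σ := by
  ext y x
  rw [entries, h, bijMatrix_apply, PiLp.single_apply]

theorem entries_adjoint {a b : ℕ} (f : HilbSpace a →ₗ[ℂ] HilbSpace b) :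
    entries (LinearMap.adjoint f) = (entries f)ᴴ := by
  ext y x
  have h := LinearMap.adjoint_inner_right f (EuclideanSpace.single y (1 : ℂ))
    (EuclideanSpace.single x 1)
  rw [EuclideanSpace.inner_single_left, EuclideanSpace.inner_single_right] at h
  simpa [entries] using h

theorem unitIso_one : unitIso 1 = (EuclideanSpace.single 0 1 : HilbSpace 1) := by
  ext i
  rw [Subsingleton.elim i 0, PiLp.single_apply, if_pos rfl]
  rfl

end FHilb

/-! ### The matrix model of qubits -/

namespace Qubit

/-- The matrices of linear maps between spaces of qubits. -/
noncomputable def matrixModel : DaggerMatrixModel Qubit where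
  idx A := Fin A.obj.dim
  fintype _ := inferInstance
  decEq _ := inferInstance
  prod _ _ := finProdFinEquiv.symm
  unique := inferInstanceAs (Unique (Fin 1))
  mat f := FHilb.entries f.hom.lin
  mat_id A := FHilb.entries_id A.obj.dim
  mat_comp f g := FHilb.entries_comp f.hom.lin g.hom.lin
  mat_tensor f g := FHilb.entries_tensorLin f.hom.lin g.hom.lin
  mat_associator A B E := by
    refine FHilb.entries_eq_bijMatrix (f := (FHilb.assocIso _ _ _).toLinearEquiv.toLinearMap)
      _ fun x => ?_
    conv_lhs => rw [FHilb.single_eq_tensor, FHilb.single_eq_tensor]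
    refine (FHilb.assocIso_apply _ _ _).trans ?_
    rw [FHilb.tensor_single, FHilb.tensor_single]
    rfl
  mat_leftUnitor A := by
    refine FHilb.entries_eq_bijMatrix (f := (FHilb.leftIso _).toLinearEquiv.toLinearMap)
      _ fun x => ?_
    conv_lhs => rw [FHilb.single_eq_tensor]
    refine (FHilb.leftIso_apply _ _).trans ?_
    rw [Subsingleton.elim (finProdFinEquiv.symm x).1 0, ← FHilb.unitIso_one,
      LinearIsometryEquiv.symm_apply_apply, one_smul]
    rfl
  mat_rightUnitor A := by
    refine FHilb.entries_eq_bijMatrix (f := (FHilb.rightIso _).toLinearEquiv.toLinearMap)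
      _ fun x => ?_
    conv_lhs => rw [FHilb.single_eq_tensor]
    refine (FHilb.rightIso_apply _ _).trans ?_
    rw [Subsingleton.elim (finProdFinEquiv.symm x).2 0, ← FHilb.unitIso_one,
      LinearIsometryEquiv.symm_apply_apply, one_smul]
    rfl
  mat_braiding A B := by
    refine FHilb.entries_eq_bijMatrix (f := (FHilb.swapIso _ _).toLinearEquiv.toLinearMap)
      _ fun x => ?_
    conv_lhs => rw [FHilb.single_eq_tensor]
    refine (FHilb.swapIso_apply _ _).trans ?_
    rw [FHilb.tensor_single]
    rfl
  mat_dagger f := FHilb.entries_adjoint f.hom.lin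

theorem eq_of_mat_eq {A B : Qubit} {f g : A ⟶ B} (h : matrixModel.mat f = matrixModel.mat g) :
    f = g :=
  ObjectProperty.hom_ext _ (FHilb.hom_ext (FHilb.entries_injective h))

/-- A linear isometry, as a morphism. -/
def ofLinearIsometry {A B : Qubit} (r : A.obj.space →ₗᵢ[ℂ] B.obj.space) : A ⟶ B :=
  ObjectProperty.homMk ⟨r.toLinearMap⟩

theorem isometries_ofLinearIsometry {A B : Qubit} (r : A.obj.space →ₗᵢ[ℂ] B.obj.space) :
    isometries Qubit (ofLinearIsometry r) := by
  refine ObjectProperty.hom_ext _ (FHilb.hom_ext ?_)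
  change LinearMap.adjoint r.toLinearMap ∘ₗ r.toLinearMap = LinearMap.id
  refine LinearMap.ext fun x => ext_inner_left ℂ fun y => ?_
  rw [LinearMap.comp_apply, LinearMap.adjoint_inner_right]
  exact r.inner_map_map y x

end Qubit

/-! ### Isometries from Gram matrices -/

/-- Two families of vectors with the same Gram matrix are related by an isometry. -/
theorem exists_linearIsometry_of_inner_eq {ι V : Type*} [Fintype ι] [NormedAddCommGroup V]
    [InnerProductSpace ℂ V] [FiniteDimensional ℂ V] (p q : ι → V)
    (h : ∀ i j, inner ℂ (p i) (p j) = inner ℂ (q i) (q j)) :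
    ∃ r : V →ₗᵢ[ℂ] V, ∀ i, r (p i) = q i := by
  classical
  let P := Fintype.linearCombination ℂ p
  let Q := Fintype.linearCombination ℂ q
  have hinner (c d : ι → ℂ) : inner ℂ (P c) (P d) = inner ℂ (Q c) (Q d) := by
    simp [P, Q, Fintype.linearCombination_apply, h]
  have hnorm (c : ι → ℂ) : ‖P c‖ = ‖Q c‖ := by
    rw [@norm_eq_sqrt_re_inner ℂ, @norm_eq_sqrt_re_inner ℂ, hinner]
  -- Equal norms make every linear relation among the `p i` hold among the `q i`, so `P c ↦ Q c` is
  -- well defined on the span.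
  have hker : P.ker ≤ Q.ker := fun c hc => by
    rw [LinearMap.mem_ker] at hc ⊢
    rw [← norm_eq_zero, ← hnorm, hc, norm_zero]
  let s : P.range →ₗ[ℂ] V := (P.ker.liftQ Q hker) ∘ₗ P.quotKerEquivRange.symm.toLinearMap
  have hs (c : ι → ℂ) : s ⟨P c, c, rfl⟩ = Q c := by
    have : P.quotKerEquivRange.symm ⟨P c, c, rfl⟩ = P.ker.mkQ c := by
      rw [LinearEquiv.symm_apply_eq]; rfl
    simp [s, this]
  let t : P.range →ₗᵢ[ℂ] V := ⟨s, by
    rintro ⟨_, c, rfl⟩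
    rw [hs, ← hnorm]; rfl⟩
  -- An isometry from a subspace of `V` into `V` extends to all of `V` by finite dimensionality.
  refine ⟨t.extend, fun i => ?_⟩
  have h1 := t.extend_apply ⟨P (Pi.single i 1), _, rfl⟩
  have h2 := hs (Pi.single i 1)
  simp only [P, Q, Fintype.linearCombination_apply_single, one_smul] at h1 h2
  exact h1.trans h2

theorem exists_linearIsometry_of_le {a b : ℕ} (h : a ≤ b) :
    Nonempty (HilbSpace a →ₗᵢ[ℂ] HilbSpace b) := by
  let v := EuclideanSpace.basisFun (Fin a) ℂ
  let w := EuclideanSpace.basisFun (Fin b) ℂ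
  refine ⟨(v.toBasis.constr ℂ (w ∘ Fin.castLE h)).isometryOfOrthonormal (v := v.toBasis)
    (by simp) ?_⟩
  rw [show (v.toBasis.constr ℂ (w ∘ Fin.castLE h)) ∘ v.toBasis = w ∘ Fin.castLE h from
    funext fun i => v.toBasis.constr_basis ℂ _ i]
  exact w.orthonormal.comp _ (Fin.castLE_injective h)

/-! ### Essential uniqueness of purifications for qubits -/

namespace Qubit

open FHilb

/-- The vectors `(⟨y| ⊗ 1) f |x⟩`. -/
noncomputable def slice {a b c : ℕ} (f : HilbSpace a →ₗ[ℂ] HilbSpace (b * c)) (k : Fin b × Fin a) :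
    HilbSpace c :=
  WithLp.toLp 2 fun i => entries f (finProdFinEquiv (k.1, i)) k.2

/-- Identifies the Gram matrix of the slices with the Kraus sum, so `∼cp` becomes equality of Gram
matrices. The inner product is conjugate linear in its first argument, hence the star on the `k`
factor. -/
theorem inner_slice {a b c : ℕ} (f : HilbSpace a →ₗ[ℂ] HilbSpace (b * c)) (k l : Fin b × Fin a) :
    inner ℂ (slice f k) (slice f l) =
      ∑ i, entries f (finProdFinEquiv (l.1, i)) l.2 *
        star (entries f (finProdFinEquiv (k.1, i)) k.2) := by
  simp [slice, PiLp.inner_apply]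

theorem slice_tensorLin_comp {a b c d : ℕ} (f : HilbSpace a →ₗ[ℂ] HilbSpace (b * c))
    (r : HilbSpace c →ₗ[ℂ] HilbSpace d) (k : Fin b × Fin a) :
    slice (tensorLin LinearMap.id r ∘ₗ f) k = r (slice f k) := by
  ext i
  rw [apply_eq_sum_entries, slice, entries_comp, entries_tensorLin, entries_id, PiLp.toLp_apply,
    Matrix.mul_apply, ← finProdFinEquiv.sum_comp, Fintype.sum_prod_type]
  simp [Matrix.one_apply, slice]

theorem slice_injective {a b c : ℕ} :
    Function.Injective (slice : (HilbSpace a →ₗ[ℂ] HilbSpace (b * c)) → _) := fun f g h => by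
  refine entries_injective (Matrix.ext fun y x => ?_)
  obtain ⟨⟨y, i⟩, rfl⟩ := finProdFinEquiv.surjective y
  exact congrArg (fun v : HilbSpace c => v i) (congrFun h (y, x))

/-- Uniqueness of Stinespring dilations up to isometry. The common target `X ⊗ Y` is again a qubit
space. -/
theorem exists_isometries_of_gram_eq {A B X Y : Qubit} (f : A ⟶ B ⊗ X) (g : A ⟶ B ⊗ Y)
    (h : ∀ k l,
      inner ℂ (slice (b := B.obj.dim) (c := X.obj.dim) f.hom.lin k) (slice f.hom.lin l) =
      inner ℂ (slice (b := B.obj.dim) (c := Y.obj.dim) g.hom.lin k) (slice g.hom.lin l)) :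
    ∃ (r : X ⟶ X ⊗ Y) (s : Y ⟶ X ⊗ Y), isometries Qubit r ∧ isometries Qubit s ∧
      f ≫ B ◁ r = g ≫ B ◁ s := by
  obtain ⟨m, hm⟩ := X.property
  obtain ⟨n, hn⟩ := Y.property
  -- Powers of two are positive, so neither factor can make the product smaller than the other.
  have hX : X.obj.dim ≤ (X ⊗ Y : Qubit).obj.dim :=
    Nat.le_mul_of_pos_right _ (by rw [hn]; positivity)
  have hY : Y.obj.dim ≤ (X ⊗ Y : Qubit).obj.dim :=
    Nat.le_mul_of_pos_left _ (by rw [hm]; positivity)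
  obtain ⟨r⟩ := exists_linearIsometry_of_le hX
  obtain ⟨s⟩ := exists_linearIsometry_of_le hY
  -- Embedding preserves the Gram matrices, so an isometry `t` of `X ⊗ Y` aligns the two embedded
  -- families; it is absorbed into the embedding of `X`.
  obtain ⟨t, ht⟩ := exists_linearIsometry_of_inner_eq
    (fun k => r (slice (b := B.obj.dim) (c := X.obj.dim) f.hom.lin k))
    (fun k => s (slice (b := B.obj.dim) (c := Y.obj.dim) g.hom.lin k)) fun k l => by
      rw [r.inner_map_map, s.inner_map_map, h]
  refine ⟨ofLinearIsometry (t.comp r), ofLinearIsometry s, isometries_ofLinearIsometry _,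
    isometries_ofLinearIsometry _, ObjectProperty.hom_ext _ (FHilb.hom_ext
      (slice_injective (b := B.obj.dim) (c := (X ⊗ Y : Qubit).obj.dim) (funext fun k => ?_)))⟩
  exact (slice_tensorLin_comp _ _ k).trans ((ht k).trans (slice_tensorLin_comp _ _ k).symm)

theorem cpRel_iff_discardOutput_eq {A B X Y : Qubit} (f : A ⟶ B ⊗ X) (g : A ⟶ B ⊗ Y) :
    CPRel f g ↔ discardOutput (DiscardCat.incl Qubit) (DiscardCat.disc Qubit) f =
      discardOutput (DiscardCat.incl Qubit) (DiscardCat.disc Qubit) g := by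
  rw [matrixModel.cpRel_iff fun _ _ h => eq_of_mat_eq h]
  constructor
  · intro h
    obtain ⟨r, s, hr, hs, e⟩ := exists_isometries_of_gram_eq f g fun k l => by
      rw [inner_slice, inner_slice]
      -- The first argument `k` of the inner product carries the conjugate, so it supplies the
      -- primed indices.
      exact h l.1 k.1 l.2 k.2
    exact DiscardCat.discardOutput_eq_of_isometries hr hs e
  · intro h y y' x x'
    rw [← matrixModel.evalDiscard_discardOutput f, ← matrixModel.evalDiscard_discardOutput g, h]

end Qubit

/-- `Qubit^⏚`, with the functor `Qubit ⥤ Qubit^⏚` and the discard maps `⏚_A`, is an environment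
structure for `Qubit`. -/
theorem mainTheorem6 :
    IsEnvironmentStructure (DiscardCat.incl Qubit) (DiscardCat.disc Qubit) :=
  isEnvironmentStructure_discardCat Qubit.cpRel_iff_discardOutput_eq
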